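/- **Fringe access.** A straight-line program (SLP) $\mathcal S$ of size $n$ is an acyclic grammar with $n$ variables (nodes), each having exactly one rule, whose right-hand side is one terminal or an ordered pair of variables; every node is reachable from the start variable. $S(v)$ denotes the string derived by the node $v$, $N_v$ its length, and $N$ the length of the string derived by the start variable. The model is the unit-cost word RAM with words of $w$ bits, with a constant number of registers and with the usual instructions (constants, moves, addition, subtraction and multiplication modulo $2^w$, division, remainder, bitwise operations, shifts, indirect load and store, conditional jumps). Time is the number of executed instructions, and space is the number of memory words. There are a fixed query program $P$ and a constant $C$ such that for every SLP $\mathcal S$ of size $n$ representing a string of length $N$, and for every $w$ with $2^w\ge C(n+N)$ and such that every terminal fits into $w$ bits, there is a data structure $D$ for $\mathcal S$ of at most $Cn$ words of $w$ bits with the following property. For every node $v$ and every position $1\le i\le N_v$, the program $P$, started with input $(v,i)$ on the memory $D$, returns the character $S(v)[i]$ after at most $$C\,\bigl(1+\log\min(i,N_v-i)+\log\log N\bigr)$$ steps, using no memory cells beyond those of $D$ and leaving $D$ unchanged at the end. Here $\log x$ is $\lfloor\log_2 x\rfloor$ for $x\ge1$, and $\log 0:=0$. In other words, in $O(n)$ space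 one can access position $i$ of $S(v)$, for every node $v$, in time $O(\log\min(i,N_v-i)+\log\log N)$. -/

import Mathlib

/-! ### Straight-line programs -/

/-- The right-hand side of a rule of a straight-line program with variables `Fin n`: one terminal
(characters are natural numbers), or an ordered pair of variables. -/
inductive SLPRule (n : ℕ) where
  | term (a : ℕ)
  | pair (l r : Fin n)

/-- The variables on a right-hand side, that is, the out-neighbours in the DAG of the program. -/
def SLPRule.HasChild {n : ℕ} : SLPRule n → Fin n → Prop
  | .term _, _ => False
  | .pair l r, u => u = l ∨ u = r

/-- A straight-line program of size `n`: one rule for each of the `n` variables (nodes), a start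
variable, and no cycle. -/
structure SLP (n : ℕ) where
  rule : Fin n → SLPRule n
  start : Fin n
  acyclic : WellFounded fun u v : Fin n => (rule v).HasChild u

namespace SLP

variable {n : ℕ}

/-- The string `S(v)` derived by the node `v`. -/
noncomputable def str (G : SLP n) : Fin n → List ℕ :=
  G.acyclic.fix fun v ih =>
    match h : G.rule v with
    | .term a => [a]
    | .pair l r =>
        ih l (by rw [h]; exact Or.inl rfl) ++ ih r (by rw [h]; exact Or.inr rfl)

theorem str_of_term (G : SLP n) {v : Fin n} {a : ℕ} (h : G.rule v = .term a) :
    G.str v = [a] := by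
  rw [str, WellFounded.fix_eq]
  split
  · next b hb => rw [h] at hb; cases hb; rfl
  · next l r hb => rw [h] at hb; cases hb

theorem str_of_pair (G : SLP n) {v l r : Fin n} (h : G.rule v = .pair l r) :
    G.str v = G.str l ++ G.str r := by
  rw [str, WellFounded.fix_eq]
  split
  · next b hb => rw [h] at hb; cases hb
  · next l' r' hb => rw [h] at hb; cases hb; rfl

/-- The length `N_v` of `S(v)`. -/
noncomputable def len (G : SLP n) (v : Fin n) : ℕ := (G.str v).length

/-- The length `N` of the string represented by the program. -/
noncomputable def totalLen (G : SLP n) : ℕ := G.len G.start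

/-- There are no useless variables: every node occurs in the derivation from the start variable. -/
def Trim (G : SLP n) : Prop :=
  ∀ v : Fin n, Relation.ReflTransGen (fun u u' => (G.rule u).HasChild u') G.start v

/-- Every terminal of the program fits into a word of `w` bits. -/
def TerminalsFit (G : SLP n) (w : ℕ) : Prop :=
  ∀ (v : Fin n) (a : ℕ), G.rule v = .term a → a < 2 ^ w

end SLP

/-! ### The word RAM -/

namespace WordRAM

/-- The arithmetic and bitwise operations of the word RAM. -/
inductive BinOp where
  | add | sub | mul | div | mod | and | or | xor | shl | shr

/-- Operations on words of `w` bits, that is, on natural numbers below `2 ^ w`; the arithmetic is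
modulo `2 ^ w`. -/
def BinOp.eval (w : ℕ) (f : BinOp) (a b : ℕ) : ℕ :=
  (match f with
    | .add => a + b
    | .sub => a + 2 ^ w - b
    | .mul => a * b
    | .div => a / b
    | .mod => a % b
    | .and => a &&& b
    | .or => a ||| b
    | .xor => a ^^^ b
    | .shl => a <<< b
    | .shr => a >>> b) % 2 ^ w

/-- The instructions. Registers are named directly, memory cells are addressed through a register,
and `l` is the index of the instruction to jump to. -/
inductive Instr where
  | const (d c : ℕ)
  | mov (d a : ℕ)
  | op (f : BinOp) (d a b : ℕ)
  | load (d a : ℕ)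
  | store (a s : ℕ)
  | jmp (l : ℕ)
  | jlt (a b l : ℕ)
  | jeq (a b l : ℕ)
  | halt

/-- A program is a finite list of instructions; it can therefore name only finitely many
registers. -/
abbrev Program := List Instr

/-- A configuration: program counter, registers, and a memory of finitely many cells. -/
structure Config where
  pc : ℕ
  reg : ℕ → ℕ
  mem : List ℕ

/-- Write `x` to register `d` and go to the next instruction. -/
def Config.write (c : Config) (d x : ℕ) : Config :=
  { c with pc := c.pc + 1, reg := Function.update c.reg d x }

/-- One step (one unit of time) with `w`-bit words. There is no successor if the machine has halted,
if the program counter is outside the program, or if the instruction addresses a cell outside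
the memory; so the length of `mem` is a hard limit on the cells in use. -/
def step (P : Program) (w : ℕ) (c : Config) : Option Config :=
  match P[c.pc]? with
  | none => none
  | some .halt => none
  | some (.const d x) => some (c.write d (x % 2 ^ w))
  | some (.mov d a) => some (c.write d (c.reg a))
  | some (.op f d a b) => some (c.write d (f.eval w (c.reg a) (c.reg b)))
  | some (.load d a) => (c.mem[c.reg a]?).map fun x => c.write d x
  | some (.store a s) =>
      if c.reg a < c.mem.length then
        some { c with pc := c.pc + 1, mem := c.mem.set (c.reg a) (c.reg s) }
      else none
  | some (.jmp l) => some { c with pc := l }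
  | some (.jlt a b l) => some { c with pc := if c.reg a < c.reg b then l else c.pc + 1 }
  | some (.jeq a b l) => some { c with pc := if c.reg a = c.reg b then l else c.pc + 1 }

/-- The configuration after exactly `s` steps, if there is one. -/
def run (P : Program) (w : ℕ) : ℕ → Config → Option Config
  | 0, c => some c
  | s + 1, c => (step P w c).bind (run P w s)

/-- The start of a query with the two arguments `x` and `y` in registers `0` and `1`, on the data
structure `D`. -/
def init (D : List ℕ) (x y : ℕ) : Config where
  pc := 0
  reg := fun r => if r = 0 then x else if r = 1 then y else 0
  mem := D

/-- On the data structure `D`, the query with arguments `x`, `y` halts after at most `t` steps with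
the answer `z` in register `0`, and it leaves the data structure as it was, ready for the next
query. -/
def Answers (P : Program) (w : ℕ) (D : List ℕ) (x y t z : ℕ) : Prop :=
  ∃ s ≤ t, ∃ c : Config, run P w s (init D x y) = some c ∧
    P[c.pc]? = some .halt ∧ c.reg 0 = z ∧ c.mem = D

end WordRAM

/-! For a threshold `T`, follow from each node its leftmost child of level (logarithm of the length)
at least `T`. These paths form a forest, and the number of symbols to the left of the final node,
the root, is a key that weakly decreases along each path. If a position `i` of `v` is not to the
right of the root (`Good`), the descent to `i` stays on the path up to the root, or up to the last
node whose key exceeds `key T v - i`, and its next step falls below level `T` (`Good.root`,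
`Good.exists_exit`). Descending thus becomes a search by key in a forest.

At scale `k` the search costs `O(2 ^ k)`. Only about every `2 ^ k`-th node is sampled, so all
entries together take linear space (`exists_sampling_rank`). Sampled nodes whose key drops by at
least `μ` within `2 ^ k` steps are linked into chains. For `i ≤ μ * 2 ^ 2 ^ k` at most `2 ^ 2 ^ k`
hops matter, and a single jump pointer per entry, whose length depends on the chain depth modulo `2
^ k`, suffices for `O(2 ^ k)` rounds (`JumpChain.exists_search`). An exit of weight at least `μ` is
then fewer than `2 * 2 ^ k` steps away (`JumpChain.Search.near`).

This is used twice, after passing to the mirror image if `i` is in the right half. Wide mode: choose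
`k` with `i < 2 ^ 2 ^ k` and `2 ^ k = O(1 + log i)`, and take `T = 2 ^ k`, `μ = 1`. The root is too
long for `i` to be to its right, so one attempt reaches a level below `2 ^ k`. Narrow mode: take `T
= lev v`. At most one child has this level, so `v` splits into a left part, the root and a right
part, and a mirror image makes the position good (`len_eq_key_add`). The scales `k = 0, 1, ...` are
tried with `μ = 2 ^ (T - 2 ^ k)`. If the descent exits to level `l`, scale `k` succeeds once `T - l
≤ 2 ^ k`, so the geometric sum of the costs is `O(T - l)`. These differences telescope to `O(2 ^ k)`
on the way to a terminal. The total is `O(1 + log (min i (N_v - i)))`; the summand `log log N` is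
not needed. -/

/-! ### Structured programs -/

namespace WordRAM

/-- Register contents. -/
abbrev Regs := ℕ → ℕ

/-- Structured programs without stores. -/
inductive Cmd where
  | instr (i : Instr)
  | seq (a b : Cmd)
  | ite (x y : ℕ) (a b : Cmd)
  | loop (pre : Cmd) (x y : ℕ) (body : Cmd)

/-- The number of instructions of the compiled command. -/
def Cmd.size : Cmd → ℕ
  | .instr _ => 1
  | .seq a b => a.size + b.size
  | .ite _ _ a b => b.size + a.size + 2
  | .loop pre _ _ body => pre.size + body.size + 3

/-- The code of a command that is placed at the address `p`. -/
def Cmd.code : Cmd → ℕ → List Instr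
  | .instr i, _ => [i]
  | .seq a b, p => a.code p ++ b.code (p + a.size)
  | .ite x y a b, p =>
      [.jlt x y (p + b.size + 2)] ++ (b.code (p + 1) ++ ([.jmp (p + b.size + a.size + 2)] ++
        a.code (p + b.size + 2)))
  | .loop pre x y body, p =>
      pre.code p ++ ([.jlt x y (p + pre.size + 2)] ++ ([.jmp (p + pre.size + body.size + 3)] ++
        (body.code (p + pre.size + 2) ++ [.jmp p])))

theorem Cmd.length_code (c : Cmd) (p : ℕ) : (c.code p).length = c.size := by
  induction c generalizing p with
  | instr i => rfl
  | seq a b iha ihb => simp [code, size, iha, ihb]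
  | ite x y a b iha ihb => simp [code, size, iha, ihb]; omega
  | loop pre x y body ihp ihb => simp [code, size, ihp, ihb]; omega

/-- Big-step semantics on a fixed memory `D`: from the registers `ρ` the command ends after `t`
steps with the registers `ρ'`. -/
inductive Exec (D : List ℕ) (w : ℕ) : Cmd → Regs → ℕ → Regs → Prop
  | instr {i : Instr} {ρ ρ' : Regs}
      (h : ∀ (P : Program) (p : ℕ), P[p]? = some i → step P w ⟨p, ρ, D⟩ = some ⟨p + 1, ρ', D⟩) :
      Exec D w (.instr i) ρ 1 ρ'
  | seq {a b : Cmd} {ρ ρ₁ ρ₂ : Regs} {t t' : ℕ} (ha : Exec D w a ρ t ρ₁)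
      (hb : Exec D w b ρ₁ t' ρ₂) : Exec D w (.seq a b) ρ (t + t') ρ₂
  | ite_true {x y : ℕ} {a b : Cmd} {ρ ρ' : Regs} {t : ℕ} (h : ρ x < ρ y) (ha : Exec D w a ρ t ρ') :
      Exec D w (.ite x y a b) ρ (1 + t) ρ'
  | ite_false {x y : ℕ} {a b : Cmd} {ρ ρ' : Regs} {t : ℕ} (h : ¬ρ x < ρ y)
      (hb : Exec D w b ρ t ρ') : Exec D w (.ite x y a b) ρ (1 + (t + 1)) ρ'
  | loop_done {pre body : Cmd} {x y : ℕ} {ρ ρ₁ : Regs} {t : ℕ} (hp : Exec D w pre ρ t ρ₁)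
      (h : ¬ρ₁ x < ρ₁ y) : Exec D w (.loop pre x y body) ρ (t + 2) ρ₁
  | loop_step {pre body : Cmd} {x y : ℕ} {ρ ρ₁ ρ₂ ρ₃ : Regs} {t t' t'' : ℕ}
      (hp : Exec D w pre ρ t ρ₁) (h : ρ₁ x < ρ₁ y) (hb : Exec D w body ρ₁ t' ρ₂)
      (hl : Exec D w (.loop pre x y body) ρ₂ t'' ρ₃) :
      Exec D w (.loop pre x y body) ρ (t + (1 + (t' + (1 + t'')))) ρ₃

theorem run_add (P : Program) (w s t : ℕ) (c : Config) :
    run P w (s + t) c = (run P w s c).bind (run P w t) := by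
  induction s generalizing c with
  | zero => simp [run]
  | succ s ih =>
      rw [Nat.add_right_comm]
      simp only [run]
      cases step P w c with
      | none => rfl
      | some d => simpa using ih d

theorem run_trans {P : Program} {w s t : ℕ} {c d e : Config} (h : run P w s c = some d)
    (h' : run P w t d = some e) : run P w (s + t) c = some e := by
  rw [run_add, h]; exact h'

/-- The code `l` stands in `P` at the address `p`. -/
def CodeAt (P : Program) (p : ℕ) (l : List Instr) : Prop :=
  ∀ j < l.length, P[p + j]? = l[j]?

theorem CodeAt.left {P : Program} {p : ℕ} {l l' : List Instr} (h : CodeAt P p (l ++ l')) :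
    CodeAt P p l := fun j hj => by
  rw [h j (by simp; omega), List.getElem?_append_left hj]

theorem CodeAt.right {P : Program} {p : ℕ} {l l' : List Instr} (h : CodeAt P p (l ++ l')) :
    CodeAt P (p + l.length) l' := fun j hj => by
  rw [Nat.add_assoc, h (l.length + j) (by simp; omega), List.getElem?_append_right (by omega)]
  simp

theorem CodeAt.single {P : Program} {p : ℕ} {i : Instr} (h : CodeAt P p [i]) :
    P[p]? = some i := by
  simpa using h 0 (by simp)

/-- Jump targets are absolute, but the code is generated for the address where it stands, so a
big-step derivation can be replayed at any place in a program. -/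
theorem Exec.run {D : List ℕ} {w : ℕ} {c : Cmd} {ρ ρ' : Regs} {t : ℕ} (h : Exec D w c ρ t ρ')
    {P : Program} {p : ℕ} (hc : CodeAt P p (c.code p)) :
    run P w t ⟨p, ρ, D⟩ = some ⟨p + c.size, ρ', D⟩ := by
  induction h generalizing p with
  | instr h => simp [WordRAM.run, h P p hc.single, Cmd.size]
  | @seq a b _ _ _ _ _ _ _ iha ihb =>
      have h2 := hc.right
      rw [a.length_code] at h2
      rw [Cmd.size, ← Nat.add_assoc]
      exact run_trans (iha hc.left) (ihb h2)
  | @ite_true x y a b ρ _ _ h _ iha =>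
      have h1 := hc.left.single
      have h2 := hc.right.right.right
      simp only [List.length_singleton, Cmd.length_code] at h2
      have e : p + 1 + b.size + 1 = p + b.size + 2 := by omega
      rw [e] at h2
      have h3 := iha h2
      refine run_trans (s := 1) (d := ⟨p + b.size + 2, ρ, D⟩) ?_ ?_
      · simp [WordRAM.run, step, h1, h]
      · rw [h3, Cmd.size]; congr 2; omega
  | @ite_false x y a b ρ _ _ h _ ihb =>
      have h1 := hc.left.single
      have h2 := hc.right.left
      have h4 := hc.right.right.left.single
      simp only [List.length_singleton, Cmd.length_code] at h2 h4
      have h3 := ihb h2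
      refine run_trans (s := 1) (d := ⟨p + 1, ρ, D⟩) ?_ (run_trans h3 ?_)
      · simp [WordRAM.run, step, h1, h]
      · simp [WordRAM.run, step, h4, Cmd.size]; omega
  | @loop_done pre body x y _ _ _ _ h ihp =>
      have h1 := hc.right.left.single
      have h2 := hc.right.right.left.single
      simp only [List.length_singleton, Cmd.length_code] at h1 h2
      refine run_trans (ihp hc.left) ?_
      simp [WordRAM.run, step, h1, h, h2, Cmd.size]; omega
  | @loop_step pre body x y _ ρ₁ ρ₂ _ _ _ _ _ h _ _ ihp ihb ihl =>
      have h1 := hc.right.left.single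
      have h3 := hc.right.right.right.left
      have h4 := hc.right.right.right.right.single
      simp only [List.length_singleton, Cmd.length_code] at h1 h3 h4
      have e : p + pre.size + 1 + 1 = p + pre.size + 2 := by omega
      rw [e] at h3 h4
      refine run_trans (ihp hc.left) (run_trans (d := ⟨p + pre.size + 2, ρ₁, D⟩) ?_
        (run_trans (ihb h3) (run_trans (d := ⟨p, ρ₂, D⟩) ?_ (ihl hc))))
      · simp [WordRAM.run, step, h1, h]
      · simp [WordRAM.run, step, h4]

/-- The program that executes a command and halts. -/
def Cmd.program (c : Cmd) : Program := c.code 0 ++ [.halt]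

theorem Exec.answers {D : List ℕ} {w x y t T z : ℕ} {c : Cmd} {ρ' : Regs}
    (h : Exec D w c (init D x y).reg t ρ') (ht : t ≤ T) (hz : ρ' 0 = z) :
    Answers c.program w D x y T z := by
  have hc : CodeAt c.program 0 (c.code 0 ++ [.halt]) := fun j _ => by
    rw [Nat.zero_add, Cmd.program]
  refine ⟨t, ht, ⟨0 + c.size, ρ', D⟩, h.run hc.left, ?_, hz, rfl⟩
  have := hc.right.single
  rwa [c.length_code] at this

/-! ### Postconditions -/

/-- The command ends, and the number of steps and the final registers satisfy `Q`. -/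
def Post (D : List ℕ) (w : ℕ) (c : Cmd) (ρ : Regs) (Q : ℕ → Regs → Prop) : Prop :=
  ∃ t ρ', Exec D w c ρ t ρ' ∧ Q t ρ'

variable {D : List ℕ} {w : ℕ}

theorem Post.mono {c : Cmd} {ρ : Regs} {Q Q' : ℕ → Regs → Prop} (h : Post D w c ρ Q)
    (hQ : ∀ t ρ', Q t ρ' → Q' t ρ') : Post D w c ρ Q' := by
  obtain ⟨t, ρ', h, hq⟩ := h
  exact ⟨t, ρ', h, hQ t ρ' hq⟩

theorem Post.seq {a b : Cmd} {ρ : Regs} {Q : ℕ → Regs → Prop}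
    (h : Post D w a ρ fun t ρ₁ => Post D w b ρ₁ fun t' ρ₂ => Q (t + t') ρ₂) :
    Post D w (.seq a b) ρ Q := by
  obtain ⟨t, ρ₁, h, t', ρ₂, h', hq⟩ := h
  exact ⟨_, _, .seq h h', hq⟩

theorem Post.ite {x y : ℕ} {a b : Cmd} {ρ : Regs} {Q : ℕ → Regs → Prop}
    (ha : ρ x < ρ y → Post D w a ρ fun t ρ' => Q (1 + t) ρ')
    (hb : ¬ρ x < ρ y → Post D w b ρ fun t ρ' => Q (1 + (t + 1)) ρ') :
    Post D w (.ite x y a b) ρ Q := by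
  by_cases h : ρ x < ρ y
  · obtain ⟨t, ρ', h', hq⟩ := ha h
    exact ⟨_, _, .ite_true h h', hq⟩
  · obtain ⟨t, ρ', h', hq⟩ := hb h
    exact ⟨_, _, .ite_false h h', hq⟩

theorem Post.loop {pre body : Cmd} {x y : ℕ} {ρ : Regs} {Q : ℕ → Regs → Prop}
    (h : Post D w pre ρ fun t ρ₁ => (¬ρ₁ x < ρ₁ y → Q (t + 2) ρ₁) ∧
      (ρ₁ x < ρ₁ y → Post D w body ρ₁ fun t' ρ₂ =>
        Post D w (.loop pre x y body) ρ₂ fun t'' ρ₃ => Q (t + (1 + (t' + (1 + t'')))) ρ₃)) :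
    Post D w (.loop pre x y body) ρ Q := by
  obtain ⟨t, ρ₁, hp, h1, h2⟩ := h
  by_cases h : ρ₁ x < ρ₁ y
  · obtain ⟨t', ρ₂, hb, t'', ρ₃, hl, hq⟩ := h2 h
    exact ⟨_, _, .loop_step hp h hb hl, hq⟩
  · exact ⟨_, _, .loop_done hp h, h1 h⟩

/-- Load the constant `x`. -/
abbrev Cmd.const (d x : ℕ) : Cmd := .instr (.const d x)
/-- Copy a register. -/
abbrev Cmd.mov (d a : ℕ) : Cmd := .instr (.mov d a)
/-- Apply an operation to two registers. -/
abbrev Cmd.op (f : BinOp) (d a b : ℕ) : Cmd := .instr (.op f d a b)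
/-- Load the field `f` of the record whose address is in register `a`. -/
def Cmd.field (d a f : ℕ) : Cmd :=
  .seq (.const d f) (.seq (.op .add d a d) (.instr (.load d d)))

theorem Post.const {d x : ℕ} {ρ : Regs} {Q : ℕ → Regs → Prop} (hx : x < 2 ^ w)
    (h : Q 1 (Function.update ρ d x)) : Post D w (.const d x) ρ Q :=
  ⟨1, _, .instr fun P p hp => by simp [step, hp, Config.write, Nat.mod_eq_of_lt hx], h⟩

theorem Post.mov {d a : ℕ} {ρ : Regs} {Q : ℕ → Regs → Prop}
    (h : Q 1 (Function.update ρ d (ρ a))) : Post D w (.mov d a) ρ Q :=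
  ⟨1, _, .instr fun P p hp => by simp [step, hp, Config.write], h⟩

theorem Post.op {f : BinOp} {d a b z : ℕ} {ρ : Regs} {Q : ℕ → Regs → Prop}
    (hz : f.eval w (ρ a) (ρ b) = z) (h : Q 1 (Function.update ρ d z)) :
    Post D w (.op f d a b) ρ Q :=
  ⟨1, _, .instr fun P p hp => by simp [step, hp, Config.write, hz], h⟩

theorem Post.load {d a z : ℕ} {ρ : Regs} {Q : ℕ → Regs → Prop}
    (hz : D[ρ a]? = some z) (h : Q 1 (Function.update ρ d z)) :
    Post D w (.instr (.load d a)) ρ Q :=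
  ⟨1, _, .instr fun P p hp => by simp [step, hp, Config.write, hz], h⟩

theorem Post.add {d a b z : ℕ} {ρ : Regs} {Q : ℕ → Regs → Prop}
    (hz : ρ a + ρ b = z) (hw : z < 2 ^ w) (h : Q 1 (Function.update ρ d z)) :
    Post D w (.op .add d a b) ρ Q :=
  .op (by simp [BinOp.eval, hz, Nat.mod_eq_of_lt hw]) h

theorem Post.mul {d a b z : ℕ} {ρ : Regs} {Q : ℕ → Regs → Prop}
    (hz : ρ a * ρ b = z) (hw : z < 2 ^ w) (h : Q 1 (Function.update ρ d z)) :
    Post D w (.op .mul d a b) ρ Q :=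
  .op (by simp [BinOp.eval, hz, Nat.mod_eq_of_lt hw]) h

theorem Post.sub {d a b z : ℕ} {ρ : Regs} {Q : ℕ → Regs → Prop}
    (hz : ρ b + z = ρ a) (hw : ρ a < 2 ^ w) (h : Q 1 (Function.update ρ d z)) :
    Post D w (.op .sub d a b) ρ Q :=
  .op (by
    have e : ρ a + 2 ^ w - ρ b = z + 2 ^ w := by omega
    simp only [BinOp.eval, e, Nat.add_mod_right]
    exact Nat.mod_eq_of_lt (by omega)) h

theorem Post.shr {d a b z : ℕ} {ρ : Regs} {Q : ℕ → Regs → Prop}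
    (hz : ρ a >>> ρ b = z) (hw : ρ a < 2 ^ w) (h : Q 1 (Function.update ρ d z)) :
    Post D w (.op .shr d a b) ρ Q :=
  .op (by
    have : ρ a >>> ρ b ≤ ρ a := by rw [Nat.shiftRight_eq_div_pow]; exact Nat.div_le_self _ _
    simp only [BinOp.eval, ← hz]
    exact Nat.mod_eq_of_lt (by omega)) h

theorem Post.field {d a f z : ℕ} {ρ : Regs} {Q : ℕ → Regs → Prop} (hda : d ≠ a)
    (hD : D.length ≤ 2 ^ w) (hz : D[ρ a + f]? = some z) (h : Q 3 (Function.update ρ d z)) :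
    Post D w (.field d a f) ρ Q := by
  have hlt : ρ a + f < 2 ^ w := lt_of_lt_of_le (List.getElem?_eq_some_iff.1 hz).1 hD
  refine .seq (.const (by omega) (.seq (.add (z := ρ a + f) ?_ hlt (.load (z := z) ?_ ?_))))
  · simp [hda.symm]
  · simpa using hz
  · simpa using h

end WordRAM

/-! ### Access graphs -/

/-- A binary DAG whose nodes derive strings, together with a mirror image for each node. -/
structure AccessGraph (V : Type) where
  len : V → ℕ
  left : V → V
  right : V → V
  mirror : V → V
  char : V → ℕ → ℕ
  len_pos : ∀ v, 1 ≤ len v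
  len_eq : ∀ v, 2 ≤ len v → len v = len (left v) + len (right v)
  char_left : ∀ v i, 2 ≤ len v → 1 ≤ i → i ≤ len (left v) → char v i = char (left v) i
  char_right : ∀ v i, 2 ≤ len v → len (left v) < i → char v i = char (right v) (i - len (left v))
  len_mirror : ∀ v, len (mirror v) = len v
  left_mirror : ∀ v, left (mirror v) = mirror (right v)
  right_mirror : ∀ v, right (mirror v) = mirror (left v)
  char_mirror : ∀ v i, 1 ≤ i → i ≤ len v → char (mirror v) (len v + 1 - i) = char v i

namespace AccessGraph

variable {V : Type} (G : AccessGraph V)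

/-- The level of a node: the logarithm of its length. -/
def lev (v : V) : ℕ := Nat.log 2 (G.len v)

theorem le_lev {T : ℕ} {v : V} : T ≤ G.lev v ↔ 2 ^ T ≤ G.len v :=
  Nat.le_log_iff_pow_le (by norm_num) (by have := G.len_pos v; omega)

theorem lev_lt {T : ℕ} {v : V} : G.lev v < T ↔ G.len v < 2 ^ T := by
  rw [← not_le, le_lev, not_le]

theorem two_le_len {T : ℕ} {v : V} (hT : 1 ≤ T) (hv : T ≤ G.lev v) : 2 ≤ G.len v := by
  have := G.le_lev.1 hv
  have : 2 ^ 1 ≤ 2 ^ T := Nat.pow_le_pow_right (by norm_num) hT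
  omega

theorem len_left_lt {v : V} (hv : 2 ≤ G.len v) : G.len (G.left v) < G.len v := by
  have := G.len_eq v hv; have := G.len_pos (G.right v); omega

theorem len_right_lt {v : V} (hv : 2 ≤ G.len v) : G.len (G.right v) < G.len v := by
  have := G.len_eq v hv; have := G.len_pos (G.left v); omega

/-- The node `v` has a child of level at least `T`. -/
def Inner (T : ℕ) (v : V) : Prop :=
  2 ≤ G.len v ∧ (T ≤ G.lev (G.left v) ∨ T ≤ G.lev (G.right v))

open Classical in
/-- The leftmost child of level at least `T`; nodes without such a child are fixed. -/
noncomputable def next (T : ℕ) (v : V) : V :=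
  if G.Inner T v then if T ≤ G.lev (G.left v) then G.left v else G.right v else v

open Classical in
/-- The length of the string to the left of `next T v` in `v`. -/
noncomputable def wt (T : ℕ) (v : V) : ℕ :=
  if G.Inner T v then if T ≤ G.lev (G.left v) then 0 else G.len (G.left v) else 0

/-! ### Paths of high-level children, their keys and roots. -/

variable {G}

theorem next_of_not_inner {T : ℕ} {v : V} (h : ¬G.Inner T v) : G.next T v = v := by simp [next, h]

theorem wt_of_not_inner {T : ℕ} {v : V} (h : ¬G.Inner T v) : G.wt T v = 0 := by simp [wt, h]

theorem Inner.cases {T : ℕ} {v : V} (h : G.Inner T v) :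
    (T ≤ G.lev (G.left v) ∧ G.next T v = G.left v ∧ G.wt T v = 0) ∨
    (G.lev (G.left v) < T ∧ T ≤ G.lev (G.right v) ∧ G.next T v = G.right v ∧
      G.wt T v = G.len (G.left v)) := by
  by_cases hl : T ≤ G.lev (G.left v)
  · left; simp [next, wt, h, hl]
  · right
    refine ⟨not_le.1 hl, h.2.resolve_left hl, ?_⟩
    simp [next, wt, h, hl]

theorem Inner.len_next_lt {T : ℕ} {v : V} (h : G.Inner T v) : G.len (G.next T v) < G.len v := by
  rcases h.cases with ⟨_, e, _⟩ | ⟨_, _, e, _⟩ <;> rw [e]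
  · exact G.len_left_lt h.1
  · exact G.len_right_lt h.1

theorem Inner.le_lev_next {T : ℕ} {v : V} (h : G.Inner T v) : T ≤ G.lev (G.next T v) := by
  rcases h.cases with ⟨h, e, _⟩ | ⟨_, h, e, _⟩ <;> rw [e] <;> exact h

theorem le_lev_next {T : ℕ} {v : V} (h : T ≤ G.lev v) : T ≤ G.lev (G.next T v) := by
  by_cases hi : G.Inner T v
  · exact hi.le_lev_next
  · rwa [next_of_not_inner hi]

theorem lev_mono {u v : V} (h : G.len u ≤ G.len v) : G.lev u ≤ G.lev v := Nat.log_mono_right h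

theorem len_next_le {T : ℕ} {v : V} : G.len (G.next T v) ≤ G.len v := by
  by_cases hi : G.Inner T v
  · exact hi.len_next_lt.le
  · rw [next_of_not_inner hi]

open Classical in
/-- The length of the string to the left of the root in `v`. -/
noncomputable def key (G : AccessGraph V) (T : ℕ) (v : V) : ℕ :=
  if _h : G.Inner T v then G.wt T v + G.key T (G.next T v) else 0
termination_by G.len v
decreasing_by exact Inner.len_next_lt ‹_›

open Classical in
/-- The end of the path `next T`. -/
noncomputable def root (G : AccessGraph V) (T : ℕ) (v : V) : V :=
  if _h : G.Inner T v then G.root T (G.next T v) else v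
termination_by G.len v
decreasing_by exact Inner.len_next_lt ‹_›

open Classical in
/-- The length of the path `next T`. -/
noncomputable def depth (G : AccessGraph V) (T : ℕ) (v : V) : ℕ :=
  if _h : G.Inner T v then G.depth T (G.next T v) + 1 else 0
termination_by G.len v
decreasing_by exact Inner.len_next_lt ‹_›

theorem key_of_not_inner {T : ℕ} {v : V} (h : ¬G.Inner T v) : G.key T v = 0 := by
  rw [key]; simp [h]

theorem key_next {T : ℕ} {v : V} : G.key T v = G.wt T v + G.key T (G.next T v) := by
  by_cases h : G.Inner T v
  · rw [key]; simp [h]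
  · rw [next_of_not_inner h, wt_of_not_inner h, zero_add]

theorem root_next {T : ℕ} {v : V} : G.root T (G.next T v) = G.root T v := by
  by_cases h : G.Inner T v
  · conv_rhs => rw [root]
    simp [h]
  · rw [next_of_not_inner h]

theorem root_of_not_inner {T : ℕ} {v : V} (h : ¬G.Inner T v) : G.root T v = v := by
  rw [root]; simp [h]

theorem depth_of_inner {T : ℕ} {v : V} (h : G.Inner T v) :
    G.depth T v = G.depth T (G.next T v) + 1 := by
  rw [depth]; simp [h]

theorem depth_of_not_inner {T : ℕ} {v : V} (h : ¬G.Inner T v) : G.depth T v = 0 := by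
  rw [depth]; simp [h]

theorem inner_iff_depth_pos {T : ℕ} {v : V} : G.Inner T v ↔ 0 < G.depth T v := by
  by_cases h : G.Inner T v
  · simp [h, depth_of_inner h]
  · simp [h, depth_of_not_inner h]

theorem depth_next {T : ℕ} {v : V} : G.depth T (G.next T v) = G.depth T v - 1 := by
  by_cases h : G.Inner T v
  · rw [depth_of_inner h]; omega
  · rw [next_of_not_inner h, depth_of_not_inner h]

theorem depth_iterate {T : ℕ} (j : ℕ) {v : V} :
    G.depth T ((G.next T)^[j] v) = G.depth T v - j := by
  induction j with
  | zero => rfl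
  | succ j ih => rw [Function.iterate_succ_apply', depth_next, ih]; omega

theorem key_iterate_le {T : ℕ} {i j : ℕ} (h : i ≤ j) {v : V} :
    G.key T ((G.next T)^[j] v) ≤ G.key T ((G.next T)^[i] v) := by
  induction j, h using Nat.le_induction with
  | base => exact le_rfl
  | succ j _ ih =>
      rw [Function.iterate_succ_apply']
      have := key_next (G := G) (T := T) (v := (G.next T)^[j] v)
      omega

theorem le_lev_iterate {T : ℕ} {v : V} (h : T ≤ G.lev v) (j : ℕ) :
    T ≤ G.lev ((G.next T)^[j] v) := by
  induction j with
  | zero => exact h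
  | succ j ih => rw [Function.iterate_succ_apply']; exact le_lev_next ih

theorem len_iterate_le {T : ℕ} {v : V} (j : ℕ) :
    G.len ((G.next T)^[j] v) ≤ G.len v := by
  induction j with
  | zero => exact le_rfl
  | succ j ih => rw [Function.iterate_succ_apply']; exact len_next_le.trans ih

/-- Along the path lengths never grow and levels stay at least the threshold. Hence the nodes of a
narrow path all have the same level, and taking the level as threshold is consistent along it. -/
theorem lev_iterate_eq {v : V} (j : ℕ) :
    G.lev ((G.next (G.lev v))^[j] v) = G.lev v :=
  le_antisymm (lev_mono (len_iterate_le j)) (le_lev_iterate le_rfl j)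

theorem exists_root_eq {T : ℕ} (v : V) :
    ∃ j, G.root T v = (G.next T)^[j] v ∧ ¬G.Inner T (G.root T v) := by
  induction hn : G.len v using Nat.strong_induction_on generalizing v with
  | _ n ih =>
    by_cases h : G.Inner T v
    · obtain ⟨j, hj, hr⟩ := ih _ (hn ▸ h.len_next_lt) (G.next T v) rfl
      rw [root_next] at hj hr
      exact ⟨j + 1, hj, hr⟩
    · exact ⟨0, root_of_not_inner h, by rwa [root_of_not_inner h]⟩

theorem le_lev_root {T : ℕ} {v : V} (h : T ≤ G.lev v) : T ≤ G.lev (G.root T v) := by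
  obtain ⟨j, e, -⟩ := G.exists_root_eq (T := T) v
  rw [e]; exact le_lev_iterate h j

theorem key_root {T : ℕ} {v : V} : G.key T (G.root T v) = 0 :=
  key_of_not_inner (G.exists_root_eq v).choose_spec.2

/-- The root occurs inside `v` right after `key T v` symbols. -/
theorem key_add_len_root_le {T : ℕ} (v : V) : G.key T v + G.len (G.root T v) ≤ G.len v := by
  induction hn : G.len v using Nat.strong_induction_on generalizing v with
  | _ n ih =>
    by_cases h : G.Inner T v
    · have h1 := ih _ (hn ▸ h.len_next_lt) (G.next T v) rfl
      rw [root_next] at h1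
      rw [key_next]
      have := G.len_eq v h.1
      rcases h.cases with ⟨_, e, e'⟩ | ⟨_, _, e, e'⟩ <;> rw [e'] <;> rw [e] at h1 ⊢ <;> omega
    · rw [root_of_not_inner h, key_of_not_inner h]; omega

/-! ### Descent -/

/-- The position `i` of `v` is not to the right of the root. -/
def Good (G : AccessGraph V) (T : ℕ) (v : V) (i : ℕ) : Prop :=
  T ≤ G.lev v ∧ 1 ≤ i ∧ i ≤ G.key T v + G.len (G.root T v)

/-- One step of the descent to a position. -/
def desc (G : AccessGraph V) (s : V × ℕ) : V × ℕ :=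
  if s.2 ≤ G.len (G.left s.1) then (G.left s.1, s.2)
  else (G.right s.1, s.2 - G.len (G.left s.1))

theorem len_desc_lt {s : V × ℕ} (h : 2 ≤ G.len s.1) : G.len (G.desc s).1 < G.len s.1 := by
  unfold desc
  split
  · exact G.len_left_lt h
  · exact G.len_right_lt h

/-- The descent to a position, until the level is below `T`. -/
def drop (G : AccessGraph V) (T : ℕ) (s : V × ℕ) : V × ℕ :=
  if _h : T ≤ G.lev s.1 ∧ 2 ≤ G.len s.1 then G.drop T (G.desc s) else s
termination_by G.len s.1
decreasing_by exact len_desc_lt (And.right ‹_›)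

theorem drop_desc {T : ℕ} {s : V × ℕ} (hT : 1 ≤ T) (h : T ≤ G.lev s.1) :
    G.drop T (G.desc s) = G.drop T s := by
  conv_rhs => rw [drop]
  simp [h, G.two_le_len hT h]

theorem drop_of_lt {T : ℕ} {s : V × ℕ} (h : G.lev s.1 < T) : G.drop T s = s := by
  rw [drop]; simp [not_le.2 h]

theorem lev_drop_lt {T : ℕ} (hT : 1 ≤ T) (s : V × ℕ) : G.lev (G.drop T s).1 < T := by
  induction hn : G.len s.1 using Nat.strong_induction_on generalizing s with
  | _ n ih =>
    by_cases h : T ≤ G.lev s.1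
    · rw [← drop_desc hT h]
      exact ih _ (hn ▸ len_desc_lt (G.two_le_len hT h)) _ rfl
    · rw [drop_of_lt (not_le.1 h)]; exact not_le.1 h

theorem desc_spec {s : V × ℕ} (h : 2 ≤ G.len s.1) (h1 : 1 ≤ s.2) (h2 : s.2 ≤ G.len s.1) :
    G.char (G.desc s).1 (G.desc s).2 = G.char s.1 s.2 ∧ 1 ≤ (G.desc s).2 ∧
      (G.desc s).2 ≤ G.len (G.desc s).1 := by
  have := G.len_eq _ h
  unfold desc
  split
  · next h' => exact ⟨(G.char_left _ _ h h1 h').symm, h1, h'⟩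
  · next h' => exact ⟨(G.char_right _ _ h (not_le.1 h')).symm, by simp only; omega,
      by simp only; omega⟩

theorem drop_spec {T : ℕ} (s : V × ℕ) (h1 : 1 ≤ s.2) (h2 : s.2 ≤ G.len s.1) :
    G.char (G.drop T s).1 (G.drop T s).2 = G.char s.1 s.2 ∧ 1 ≤ (G.drop T s).2 ∧
      (G.drop T s).2 ≤ G.len (G.drop T s).1 := by
  induction hn : G.len s.1 using Nat.strong_induction_on generalizing s with
  | _ n ih =>
    rw [drop]
    split
    · next h =>
      obtain ⟨e, h3, h4⟩ := desc_spec h.2 h1 h2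
      have := ih _ (hn ▸ len_desc_lt h.2) _ h3 h4 rfl
      rwa [e] at this
    · exact ⟨rfl, h1, h2⟩

theorem Good.le_len {T i : ℕ} {v : V} (h : G.Good T v i) : i ≤ G.len v :=
  h.2.2.trans (key_add_len_root_le v)

/-- If the path goes right, a position beyond the weight goes right too; if it goes left, the
position is within the left child because it is not to the right of the root. -/
theorem Good.desc_eq {T i : ℕ} {v : V} (h : G.Good T v i) (hi : G.Inner T v)
    (hw : G.wt T v < i) :
    G.desc (v, i) = (G.next T v, i - G.wt T v) ∧ G.Good T (G.next T v) (i - G.wt T v) := by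
  obtain ⟨h1, h2, h3⟩ := h
  rw [key_next] at h3
  have hg : G.Good T (G.next T v) (i - G.wt T v) :=
    ⟨hi.le_lev_next, by omega, by rw [root_next]; omega⟩
  refine ⟨?_, hg⟩
  have := hg.le_len
  unfold desc
  rcases hi.cases with ⟨_, e, e'⟩ | ⟨_, _, e, e'⟩ <;> rw [e, e'] <;>
    rw [e, e'] at this <;> simp only
  · rw [if_pos (by omega)]; simp
  · rw [if_neg (by omega)]

/-- The path takes the leftmost child of level at least `T`, so leaving it to the left leads below
`T`; at the root both children are below `T`. -/
theorem Good.desc_cases {T i : ℕ} {v : V} (hT : 1 ≤ T) (h : G.Good T v i) :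
    (G.Inner T v ∧ G.wt T v < i ∧ G.desc (v, i) = (G.next T v, i - G.wt T v) ∧
      G.Good T (G.next T v) (i - G.wt T v)) ∨ G.lev (G.desc (v, i)).1 < T := by
  by_cases hi : G.Inner T v
  · by_cases hw : G.wt T v < i
    · exact .inl ⟨hi, hw, h.desc_eq hi hw⟩
    · right
      have h2 := h.2.1
      rcases hi.cases with ⟨_, e, e'⟩ | ⟨hl, _, e, e'⟩
      · omega
      · unfold desc
        rw [if_pos (by simp only; omega)]
        exact hl
  · right
    have hi' : ¬(T ≤ G.lev (G.left v) ∨ T ≤ G.lev (G.right v)) :=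
      fun h' => hi ⟨G.two_le_len hT h.1, h'⟩
    push Not at hi'
    unfold desc
    split
    · exact hi'.1
    · exact hi'.2

/-- The weights skipped on the path telescope to a difference of keys. So key minus position is
invariant, and the position at a far node can be computed without walking there. -/
theorem Good.iterate {T : ℕ} (hT : 1 ≤ T) (j : ℕ) {v : V} {i : ℕ} (h : G.Good T v i)
    (hj : G.key T v - G.key T ((G.next T)^[j] v) < i) :
    G.Good T ((G.next T)^[j] v) (i - (G.key T v - G.key T ((G.next T)^[j] v))) ∧
    G.drop T ((G.next T)^[j] v, i - (G.key T v - G.key T ((G.next T)^[j] v))) =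
      G.drop T (v, i) := by
  induction j generalizing v i with
  | zero => simpa using h
  | succ j ih =>
    rw [Function.iterate_succ_apply] at hj ⊢
    by_cases hi : G.Inner T v
    · have e := G.key_next (T := T) (v := v)
      have hle := key_iterate_le (G := G) (T := T) (Nat.zero_le j) (v := G.next T v)
      simp only [Function.iterate_zero, id] at hle
      have hw : G.wt T v < i := by omega
      obtain ⟨e', hg⟩ := h.desc_eq hi hw
      have := ih hg (by omega)
      have e2 : i - G.wt T v - (G.key T (G.next T v) - G.key T ((G.next T)^[j] (G.next T v))) =
        i - (G.key T v - G.key T ((G.next T)^[j] (G.next T v))) := by omega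
      rw [e2] at this
      refine ⟨this.1, this.2.trans ?_⟩
      rw [← e', drop_desc hT h.1]
    · rw [next_of_not_inner hi] at hj ⊢
      exact ih h hj

/-- A good position beyond the key lies inside the root, and the root has no child of level at least
`T`. -/
theorem Good.root {T : ℕ} (hT : 1 ≤ T) {v : V} {i : ℕ} (h : G.Good T v i)
    (hi : G.key T v < i) :
    G.Good T (G.root T v) (i - G.key T v) ∧ G.drop T (G.root T v, i - G.key T v) = G.drop T (v, i) ∧
    G.lev (G.desc (G.root T v, i - G.key T v)).1 < T := by
  obtain ⟨j, e, hr⟩ := G.exists_root_eq (T := T) v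
  have hk := G.key_root (T := T) (v := v)
  have := h.iterate hT j (by rw [← e, hk]; omega)
  rw [← e, hk, Nat.sub_zero] at this
  refine ⟨this.1, this.2, ?_⟩
  rcases this.1.desc_cases hT with h' | h'
  · exact absurd h'.1 hr
  · exact h'

/-- A position to the left of the root leaves the path at a node `(next T)^[j] v`. -/
theorem Good.exists_exit {T : ℕ} (hT : 1 ≤ T) {v : V} {i : ℕ} (h : G.Good T v i)
    (hi : i ≤ G.key T v) :
    ∃ j, G.key T ((G.next T)^[j + 1] v) ≤ G.key T v - i ∧
      G.key T v - i < G.key T ((G.next T)^[j] v) ∧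
      G.lev (G.desc ((G.next T)^[j] v, i - (G.key T v - G.key T ((G.next T)^[j] v)))).1 < T ∧
      (G.drop T (v, i)).1 = G.left ((G.next T)^[j] v) ∧
      G.wt T ((G.next T)^[j] v) = G.len (G.left ((G.next T)^[j] v)) := by
  have h1 := h.2.1
  have hex : ∃ j, G.key T ((G.next T)^[j] v) ≤ G.key T v - i := by
    obtain ⟨j, e, -⟩ := G.exists_root_eq (T := T) v
    exact ⟨j, by rw [← e, key_root]; omega⟩
  classical
  -- The exit node is the one before the first node whose key is at most `key T v - i`; that first
  -- node is not `v` itself because `1 ≤ i`.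
  obtain ⟨j, hj⟩ : ∃ j, Nat.find hex = j + 1 := by
    refine ⟨Nat.find hex - 1, ?_⟩
    have : Nat.find hex ≠ 0 := fun h0 => by
      have := Nat.find_spec hex
      rw [h0] at this
      simp only [Function.iterate_zero, id] at this
      omega
    omega
  have hs := Nat.find_spec hex
  have hm := Nat.find_min hex (m := j) (by omega)
  rw [hj] at hs
  push Not at hm
  obtain ⟨hg, hd⟩ := h.iterate hT j (by omega)
  set y := (G.next T)^[j] v with hy
  have hs' := hs
  rw [Function.iterate_succ_apply', ← hy] at hs'
  have hk := G.key_next (T := T) (v := y)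
  have hyi : G.Inner T y := by
    by_contra hn
    rw [next_of_not_inner hn] at hs'
    omega
  have hle := key_iterate_le (G := G) (T := T) (Nat.zero_le j) (v := v)
  simp only [Function.iterate_zero, id, ← hy] at hle
  refine ⟨j, hs, hm, ?_⟩
  rw [← hy]
  rcases hyi.cases with ⟨_, e, e'⟩ | ⟨hl, _, e, e'⟩
  · omega
  · have : G.desc (y, i - (G.key T v - G.key T y)) =
        (G.left y, i - (G.key T v - G.key T y)) := by
      unfold desc
      rw [if_pos (by simp only; omega)]
    refine ⟨by rw [this]; exact hl, ?_, e'⟩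
    rw [← hd, ← drop_desc hT hg.1, this, drop_of_lt hl]

/-! ### Mirror images and paths within one level. -/

theorem lev_mirror (v : V) : G.lev (G.mirror v) = G.lev v := by
  rw [lev, G.len_mirror, lev]

/-- A node of level `T` is a string to the left of the root, the root, and a string to the right of
the root. -/
theorem len_eq_key_add {T : ℕ} (v : V) (hT : 1 ≤ T) (hv : G.lev v = T) :
    G.len v = G.key T v + G.len (G.root T v) + G.key T (G.mirror v) := by
  induction hn : G.len v using Nat.strong_induction_on generalizing v with
  | _ n ih =>
    have h2 := G.two_le_len hT hv.ge
    have he := G.len_eq v h2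
    have hm : G.Inner T (G.mirror v) ↔ G.Inner T v := by
      simp only [Inner, G.len_mirror, G.left_mirror, G.right_mirror, lev_mirror]
      tauto
    by_cases h : G.Inner T v
    · have hlt : G.len v < 2 ^ (T + 1) := G.lev_lt.1 (by omega)
      have hnx := ih _ (hn ▸ h.len_next_lt) (G.next T v)
        (le_antisymm (hv ▸ lev_mono len_next_le) h.le_lev_next) rfl
      rw [root_next] at hnx
      have k1 := G.key_next (T := T) (v := v)
      have k2 := G.key_next (T := T) (v := G.mirror v)
      rcases h.cases with ⟨hl, e, e'⟩ | ⟨hl, hr, e, e'⟩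
      · have hl' := G.le_lev.1 hl
        -- Two children of level `T` would give `v` length at least `2 ^ (T + 1)`. So the path in
        -- the mirror image visits the mirrored nodes and collects the weights on the other side.
        have hr : G.lev (G.right v) < T := by rw [G.lev_lt]; rw [pow_succ] at hlt; omega
        rcases (hm.2 h).cases with ⟨hl2, _⟩ | ⟨_, _, e2, e2'⟩
        · rw [G.left_mirror, lev_mirror] at hl2; omega
        · rw [G.right_mirror] at e2
          rw [G.left_mirror, G.len_mirror] at e2'
          rw [e] at k1 hnx
          rw [e2] at k2
          omega
      · rcases (hm.2 h).cases with ⟨_, e2, e2'⟩ | ⟨hl2, _⟩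
        · rw [G.left_mirror] at e2
          rw [e] at k1 hnx
          rw [e2] at k2
          omega
        · rw [G.left_mirror, lev_mirror] at hl2; omega
    · rw [key_of_not_inner h, root_of_not_inner h, key_of_not_inner (fun h' => h (hm.1 h'))]
      omega

/-- The root takes at least `2 ^ lev v` of fewer than `2 ^ (lev v + 1)` symbols. This bounds the
range of the narrow search. -/
theorem key_lt_of_lev {v : V} : G.key (G.lev v) v < 2 ^ G.lev v := by
  have h1 := key_add_len_root_le (G := G) (T := G.lev v) v
  have h2 := G.le_lev.1 (le_lev_root (G := G) (v := v) le_rfl)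
  have h3 : G.len v < 2 ^ (G.lev v + 1) := G.lev_lt.1 (by omega)
  rw [pow_succ] at h3
  omega

end AccessGraph

/-! ### Jump pointers on sparse chains -/

namespace JumpChain

variable {V : Type} (f : V → V) (κ : V → ℕ) (m μ : ℕ) (S : V → Prop)

/-- The key decreases by at least `μ` within `m` steps from the sampled node `v`. -/
def Stop (v : V) : Prop := S v ∧ κ (f^[m] v) + μ ≤ κ v

open Classical in
/-- The first stop at distance at least `m`. -/
noncomputable def hop (v : V) : Option V :=
  if h : ∃ j, m ≤ j ∧ Stop f κ m μ S (f^[j] v) then some (f^[Nat.find h] v) else none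

/-- The node after `t` hops. -/
noncomputable def chain (t : ℕ) (v : V) : Option V :=
  (fun o : Option V => o.bind (hop f κ m μ S))^[t] (some v)

open Classical in
/-- The number of hops until the chain ends. -/
noncomputable def dep (v : V) : ℕ :=
  if h : ∃ t, chain f κ m μ S t v = none then Nat.find h else 0

/-- The jump pointer: its length is a power of two that depends on `dep v` modulo `m`. -/
noncomputable def jump (v : V) : Option V :=
  chain f κ m μ S (2 * m * 2 ^ (dep f κ m μ S v % m)) v

/-- The node exists, and its key exceeds `x`. -/
def Above (x : ℕ) (o : Option V) : Prop := ∃ u, o = some u ∧ x < κ u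

open Classical in
/-- Take the jump pointer if its key exceeds `x`. -/
noncomputable def leap (x : ℕ) (v : V) : V :=
  if Above κ x (jump f κ m μ S v) then (jump f κ m μ S v).getD v else v

/-- The search for the last node of a chain whose key exceeds `x`, in `n` rounds. -/
inductive Search (x : ℕ) : V → ℕ → V → Prop
  | done {v : V} (h : ¬Above κ x (hop f κ m μ S (leap f κ m μ S x v))) :
      Search x v 1 (leap f κ m μ S x v)
  | step {v u r : V} {n : ℕ} (h : hop f κ m μ S (leap f κ m μ S x v) = some u) (hu : x < κ u)
      (hr : Search x u n r) : Search x v (n + 1) r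

/-! ### Key decrease along hops, and the number of rounds of a search. -/

variable {f κ m μ S}

theorem hop_eq_some {v u : V} (h : hop f κ m μ S v = some u) :
    (∃ j, m ≤ j ∧ u = f^[j] v) ∧ Stop f κ m μ S u := by
  classical
  unfold hop at h
  split at h
  · next hex =>
    cases h
    obtain ⟨h1, h2⟩ := Nat.find_spec hex
    exact ⟨⟨_, h1, rfl⟩, h2⟩
  · cases h

theorem hop_of_stop {v : V} {j : ℕ} (hj : m ≤ j) (h : Stop f κ m μ S (f^[j] v)) :
    ∃ i ≤ j, hop f κ m μ S v = some (f^[i] v) := by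
  classical
  have hex : ∃ j, m ≤ j ∧ Stop f κ m μ S (f^[j] v) := ⟨j, hj, h⟩
  exact ⟨Nat.find hex, Nat.find_min' hex ⟨hj, h⟩, by rw [hop, dif_pos hex]⟩

theorem chain_succ' (t : ℕ) (v : V) :
    chain f κ m μ S (t + 1) v = (chain f κ m μ S t v).bind (hop f κ m μ S) :=
  Function.iterate_succ_apply' _ _ _

theorem chain_add {t s : ℕ} {v u : V} (h : chain f κ m μ S t v = some u) :
    chain f κ m μ S (t + s) v = chain f κ m μ S s u := by
  rw [chain, Nat.add_comm, Function.iterate_add_apply, ← chain, h, ← chain]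

theorem chain_none_of_le {t s : ℕ} (hts : t ≤ s) {v : V} (h : chain f κ m μ S t v = none) :
    chain f κ m μ S s v = none := by
  induction s, hts using Nat.le_induction with
  | base => exact h
  | succ s _ ih => rw [chain_succ', ih]; rfl

theorem key_iterate_anti (hκ : ∀ v, κ (f v) ≤ κ v) {i j : ℕ} (h : i ≤ j) (v : V) :
    κ (f^[j] v) ≤ κ (f^[i] v) := by
  induction j, h using Nat.le_induction with
  | base => exact le_rfl
  | succ j _ ih => rw [Function.iterate_succ_apply']; exact (hκ _).trans ih

theorem key_hop_le (hκ : ∀ v, κ (f v) ≤ κ v) {v u : V} (h : hop f κ m μ S v = some u) :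
    κ u ≤ κ (f^[m] v) := by
  obtain ⟨⟨j, hj, rfl⟩, -⟩ := hop_eq_some h
  exact key_iterate_anti hκ hj v

theorem key_hop_le_self (hκ : ∀ v, κ (f v) ≤ κ v) {v u : V} (h : hop f κ m μ S v = some u) :
    κ u ≤ κ v :=
  (key_hop_le hκ h).trans (key_iterate_anti hκ (Nat.zero_le m) v)

theorem stop_of_chain {t : ℕ} {v u : V} (h : chain f κ m μ S (t + 1) v = some u) :
    Stop f κ m μ S u := by
  rw [chain_succ'] at h
  obtain ⟨z, -, hz⟩ := Option.bind_eq_some_iff.1 h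
  exact (hop_eq_some hz).2

/-- A stop loses `μ` within `m` steps, and the next hop goes at least that far. Only the first hop
may be free, since `v` need not be a stop. -/
theorem key_chain_le (hκ : ∀ v, κ (f v) ≤ κ v) (t : ℕ) {v u : V}
    (h : chain f κ m μ S (t + 1) v = some u) : κ u + t * μ ≤ κ v := by
  induction t generalizing u with
  | zero => simpa using key_hop_le_self hκ h
  | succ t ih =>
    rw [chain_succ'] at h
    obtain ⟨z, hz, hu⟩ := Option.bind_eq_some_iff.1 h
    have h1 := ih hz
    have h2 := (stop_of_chain hz).2
    have h3 := key_hop_le hκ hu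
    rw [Nat.succ_mul]
    omega

theorem exists_chain_none (hκ : ∀ v, κ (f v) ≤ κ v) (hμ : 1 ≤ μ) (v : V) :
    ∃ t, chain f κ m μ S t v = none := by
  refine ⟨κ v + 1 + 1, ?_⟩
  by_contra h
  obtain ⟨u, hu⟩ := Option.ne_none_iff_exists'.1 h
  have := key_chain_le hκ _ hu
  have : (κ v + 1) * 1 ≤ (κ v + 1) * μ := Nat.mul_le_mul_left _ hμ
  omega

theorem dep_of_chain (hκ : ∀ v, κ (f v) ≤ κ v) (hμ : 1 ≤ μ) {t : ℕ} {v u : V}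
    (h : chain f κ m μ S t v = some u) : dep f κ m μ S v = t + dep f κ m μ S u := by
  classical
  have hv : ∃ t, chain f κ m μ S t v = none := exists_chain_none hκ hμ v
  have hu : ∃ t, chain f κ m μ S t u = none := exists_chain_none hκ hμ u
  rw [dep, dif_pos hv, dep, dif_pos hu]
  apply le_antisymm
  · apply Nat.find_min'
    rw [chain_add h]
    exact Nat.find_spec hu
  · have h1 := Nat.find_spec hv
    have h2 : t ≤ Nat.find hv := by
      by_contra hlt
      rw [chain_none_of_le (not_le.1 hlt).le h1] at h
      cases h
    obtain ⟨s, hs⟩ := Nat.exists_eq_add_of_le h2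
    rw [hs] at h1 ⊢
    rw [chain_add h] at h1
    exact Nat.add_le_add_left (Nat.find_min' hu h1) t

theorem Above.of_succ (hκ : ∀ v, κ (f v) ≤ κ v) {x t : ℕ} {v : V}
    (h : Above κ x (chain f κ m μ S (t + 1) v)) : Above κ x (chain f κ m μ S t v) := by
  obtain ⟨u, hu, hx⟩ := h
  rw [chain_succ'] at hu
  obtain ⟨z, hz, hu⟩ := Option.bind_eq_some_iff.1 hu
  exact ⟨z, hz, hx.trans_le (key_hop_le_self hκ hu)⟩

theorem Above.of_le (hκ : ∀ v, κ (f v) ≤ κ v) {x t s : ℕ} {v : V} (hts : t ≤ s)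
    (h : Above κ x (chain f κ m μ S s v)) : Above κ x (chain f κ m μ S t v) := by
  induction s, hts using Nat.le_induction with
  | base => exact h
  | succ s _ ih => exact ih (h.of_succ hκ)

/-- The last node with a key above `x` is `r` hops away. -/
def Dist (f : V → V) (κ : V → ℕ) (m μ : ℕ) (S : V → Prop) (x : ℕ) (v : V) (r : ℕ) : Prop :=
  Above κ x (chain f κ m μ S r v) ∧ ¬Above κ x (chain f κ m μ S (r + 1) v)

theorem exists_dist (hκ : ∀ v, κ (f v) ≤ κ v) (hμ : 1 ≤ μ) {x : ℕ} {v : V} (hx : x < κ v) :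
    ∃ r, Dist f κ m μ S x v r := by
  classical
  have hex : ∃ t, ¬Above κ x (chain f κ m μ S t v) := by
    obtain ⟨t, ht⟩ := exists_chain_none (m := m) (S := S) hκ hμ v
    exact ⟨t, fun ⟨u, hu, _⟩ => by rw [ht] at hu; cases hu⟩
  obtain ⟨r, hr⟩ : ∃ r, Nat.find hex = r + 1 := by
    refine ⟨Nat.find hex - 1, ?_⟩
    have : Nat.find hex ≠ 0 := fun h0 => by
      have := Nat.find_spec hex
      rw [h0] at this
      exact this ⟨v, rfl, hx⟩
    omega
  exact ⟨r, not_not.1 (Nat.find_min hex (by omega)), hr ▸ Nat.find_spec hex⟩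

theorem Dist.le (hκ : ∀ v, κ (f v) ≤ κ v) {x r : ℕ} {v : V} (h : Dist f κ m μ S x v r)
    (hx : x < κ v) (hQ : κ v - x ≤ μ * 2 ^ m) : r ≤ 2 ^ m := by
  cases r with
  | zero => exact Nat.zero_le _
  | succ r =>
    obtain ⟨u, hu, hxu⟩ := h.1
    have h1 := key_chain_le hκ r hu
    have : μ * r < μ * 2 ^ m := by rw [Nat.mul_comm μ r]; omega
    exact Nat.lt_of_mul_lt_mul_left this

theorem Dist.shift {x r t : ℕ} {v u : V} (h : Dist f κ m μ S x v r) (ht : t ≤ r)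
    (hu : chain f κ m μ S t v = some u) : Dist f κ m μ S x u (r - t) := by
  unfold Dist at h ⊢
  rw [← chain_add hu, ← chain_add hu]
  rwa [show t + (r - t) = r by omega, show t + (r - t + 1) = r + 1 by omega]

/-- A round is a jump, unless it overshoots, followed by one hop. Jump lengths are multiples of `m`,
so a round lowers `dep` by one modulo `m` whether or not the jump is taken. A distance below twice
the jump length falls below the jump length. -/
theorem Dist.round (hκ : ∀ v, κ (f v) ≤ κ v) (hμ : 1 ≤ μ) {x r : ℕ} {v : V}
    (h : Dist f κ m μ S x v r) :
    Search f κ m μ S x v 1 (leap f κ m μ S x v) ∨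
    ∃ u a r', (∀ n w, Search f κ m μ S x u n w → Search f κ m μ S x v (n + 1) w) ∧
      Dist f κ m μ S x u r' ∧ dep f κ m μ S v = m * a + 1 + dep f κ m μ S u ∧ r' < r ∧
      (r < 2 * (2 * m * 2 ^ (dep f κ m μ S v % m)) → r' < 2 * m * 2 ^ (dep f κ m μ S v % m)) := by
  set L := 2 * m * 2 ^ (dep f κ m μ S v % m) with hL
  obtain ⟨a, r₁, hd, hdep, hr₁, hr₂⟩ : ∃ a r₁, Dist f κ m μ S x (leap f κ m μ S x v) r₁ ∧
      dep f κ m μ S v = m * a + dep f κ m μ S (leap f κ m μ S x v) ∧ r₁ ≤ r ∧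
      (r < 2 * L → r₁ < L ∨ r₁ = 0) := by
    by_cases hl : L ≤ r
    · have hab := h.1.of_le hκ hl
      obtain ⟨u, hu, hxu⟩ := hab
      have e : leap f κ m μ S x v = u := by
        have hj : jump f κ m μ S v = some u := hu
        rw [leap, if_pos ⟨u, hj, hxu⟩, hj]; rfl
      refine ⟨2 * 2 ^ (dep f κ m μ S v % m), r - L, e ▸ h.shift hl hu, ?_, by omega,
        fun _ => by omega⟩
      rw [e, ← Nat.mul_assoc, Nat.mul_comm m 2, ← hL]
      exact dep_of_chain hκ hμ hu
    · have e : leap f κ m μ S x v = v := by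
        unfold leap
        split
        · next ha =>
          exfalso
          have h3 : L ≥ r + 1 := by omega
          exact h.2 (Above.of_le hκ h3 ha)
        · rfl
      exact ⟨0, r, by rwa [e], by rw [e]; simp, le_rfl, fun _ => by omega⟩
  cases r₁ with
  | zero => exact .inl (.done hd.2)
  | succ r₁ =>
    right
    obtain ⟨u, hu, hxu⟩ := hd.1.of_le hκ (Nat.le_add_left 1 r₁)
    have h2 := hd.shift (Nat.le_add_left 1 r₁) hu
    refine ⟨u, a, r₁, fun n w hs => .step hu hxu hs, h2, ?_, by omega, fun hlt => ?_⟩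
    · rw [hdep, dep_of_chain hκ hμ hu]; omega
    · have := hr₂ hlt; omega

theorem Dist.search_linear (hκ : ∀ v, κ (f v) ≤ κ v) (hμ : 1 ≤ μ) {x : ℕ} (r : ℕ) {v : V}
    (h : Dist f κ m μ S x v r) : ∃ n ≤ r + 1, ∃ w, Search f κ m μ S x v n w := by
  induction r using Nat.strong_induction_on generalizing v with
  | _ r ih =>
    rcases h.round hκ hμ with hs | ⟨u, a, r', hs, hd, -, hr, -⟩
    · exact ⟨1, by omega, _, hs⟩
    · obtain ⟨n, hn, w, hw⟩ := ih r' hr hd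
      exact ⟨n + 1, by omega, w, hs n w hw⟩

/-- As the residue counts down from `j`, the jump length halves in each round and so does the bound
on the distance. After residue `0` fewer than `2 * m` hops remain, which the linear bound covers. -/
theorem Dist.search_down (hκ : ∀ v, κ (f v) ≤ κ v) (hμ : 1 ≤ μ) (hm : 1 ≤ m) {x : ℕ} (j : ℕ)
    {v : V} {r : ℕ} (h : Dist f κ m μ S x v r) (hj : dep f κ m μ S v % m = j)
    (hr : r < 2 * (2 * m * 2 ^ j)) :
    ∃ n ≤ j + 1 + 2 * m, ∃ w, Search f κ m μ S x v n w := by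
  induction j generalizing v r with
  | zero =>
    rcases h.round hκ hμ with hs | ⟨u, a, r', hs, hd, -, -, hlt⟩
    · exact ⟨1, by omega, _, hs⟩
    · rw [hj] at hlt
      have := hlt hr
      obtain ⟨n, hn, w, hw⟩ := hd.search_linear hκ hμ
      exact ⟨n + 1, by omega, w, hs n w hw⟩
  | succ j ih =>
    rcases h.round hκ hμ with hs | ⟨u, a, r', hs, hd, hdep, -, hlt⟩
    · exact ⟨1, by omega, _, hs⟩
    · rw [hj] at hlt
      have h3 := hlt hr
      have hju : dep f κ m μ S u % m = j := by
        have hjm : j + 1 < m := hj ▸ Nat.mod_lt _ hm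
        rw [hdep, Nat.add_assoc, Nat.mul_add_mod, Nat.add_comm, Nat.add_mod] at hj
        rcases Nat.lt_or_ge 1 m with h1 | h1
        · rw [Nat.mod_eq_of_lt h1] at hj
          have h4 := Nat.mod_lt (dep f κ m μ S u) hm
          rcases Nat.lt_or_ge (dep f κ m μ S u % m + 1) m with h5 | h5
          · rw [Nat.mod_eq_of_lt h5] at hj; omega
          · rw [show dep f κ m μ S u % m + 1 = m by omega, Nat.mod_self] at hj; omega
        · omega
      obtain ⟨n, hn, w, hw⟩ := ih hd hju (by rw [pow_succ] at h3; linarith)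
      exact ⟨n + 1, by omega, w, hs n w hw⟩

/-- Until the residue wraps around from `0` to `m - 1`, it is enough that the distance does not
grow. Then the jump length `m * 2 ^ m` is at least the distance, and `Dist.search_down` takes over.
-/
theorem Dist.search (hκ : ∀ v, κ (f v) ≤ κ v) (hμ : 1 ≤ μ) (hm : 1 ≤ m) {x : ℕ} (j : ℕ)
    {v : V} {r : ℕ} (h : Dist f κ m μ S x v r) (hj : dep f κ m μ S v % m = j) (hr : r ≤ 2 ^ m) :
    ∃ n ≤ j + 1 + 3 * m, ∃ w, Search f κ m μ S x v n w := by
  induction j generalizing v r with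
  | zero =>
    rcases h.round hκ hμ with hs | ⟨u, a, r', hs, hd, hdep, hlt, -⟩
    · exact ⟨1, by omega, _, hs⟩
    · have hju : dep f κ m μ S u % m = m - 1 := by
        rw [hdep, Nat.add_assoc, Nat.mul_add_mod] at hj
        have h4 := Nat.mod_lt (dep f κ m μ S u) hm
        have h5 : m ∣ 1 + dep f κ m μ S u := Nat.dvd_of_mod_eq_zero hj
        have h6 : m ∣ 1 + dep f κ m μ S u % m := by
          rwa [Nat.dvd_iff_mod_eq_zero, Nat.add_mod_mod, ← Nat.dvd_iff_mod_eq_zero]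
        have := Nat.le_of_dvd (by omega) h6
        omega
      have hp : 2 ^ m = 2 * 2 ^ (m - 1) := by
        rw [← pow_succ', Nat.sub_add_cancel hm]
      have : 1 * 2 ^ (m - 1) ≤ m * 2 ^ (m - 1) := Nat.mul_le_mul_right _ hm
      obtain ⟨n, hn, w, hw⟩ := hd.search_down hκ hμ hm (m - 1) hju (by
        rw [Nat.mul_assoc 2 m]; omega)
      exact ⟨n + 1, by omega, w, hs n w hw⟩
  | succ j ih =>
    rcases h.round hκ hμ with hs | ⟨u, a, r', hs, hd, hdep, hlt, -⟩
    · exact ⟨1, by omega, _, hs⟩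
    · have hju : dep f κ m μ S u % m = j := by
        have hjm : j + 1 < m := hj ▸ Nat.mod_lt _ hm
        rw [hdep, Nat.add_assoc, Nat.mul_add_mod, Nat.add_comm, Nat.add_mod] at hj
        rw [Nat.mod_eq_of_lt (show 1 < m by omega)] at hj
        have h4 := Nat.mod_lt (dep f κ m μ S u) hm
        rcases Nat.lt_or_ge (dep f κ m μ S u % m + 1) m with h5 | h5
        · rw [Nat.mod_eq_of_lt h5] at hj; omega
        · rw [show dep f κ m μ S u % m + 1 = m by omega, Nat.mod_self] at hj; omega
      obtain ⟨n, hn, w, hw⟩ := ih hd hju (by omega)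
      exact ⟨n + 1, by omega, w, hs n w hw⟩

theorem exists_iterate_of_chain (t : ℕ) {v u : V} (h : chain f κ m μ S t v = some u) :
    ∃ j, u = f^[j] v := by
  induction t generalizing u with
  | zero => cases h; exact ⟨0, rfl⟩
  | succ t ih =>
    rw [chain_succ'] at h
    obtain ⟨z, hz, hu⟩ := Option.bind_eq_some_iff.1 h
    obtain ⟨i, rfl⟩ := ih hz
    obtain ⟨⟨j, -, rfl⟩, -⟩ := hop_eq_some hu
    exact ⟨j + i, (Function.iterate_add_apply _ _ _ _).symm⟩

theorem leap_spec {x : ℕ} (v : V) (hx : x < κ v) :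
    x < κ (leap f κ m μ S x v) ∧ ∃ j, leap f κ m μ S x v = f^[j] v := by
  unfold leap
  split
  · next h =>
    obtain ⟨u, hu, hxu⟩ := h
    rw [hu]
    exact ⟨hxu, exists_iterate_of_chain _ hu⟩
  · exact ⟨hx, 0, rfl⟩

theorem Search.spec {x n : ℕ} {v r : V} (h : Search f κ m μ S x v n r) (hx : x < κ v) :
    x < κ r ∧ ¬Above κ x (hop f κ m μ S r) ∧ ∃ j, r = f^[j] v := by
  induction h with
  | done h => exact ⟨(leap_spec _ hx).1, h, (leap_spec _ hx).2⟩
  | @step v u r n h hu _ ih =>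
    obtain ⟨h1, h2, i, rfl⟩ := ih hu
    obtain ⟨⟨j, -, rfl⟩, -⟩ := hop_eq_some h
    obtain ⟨l, e⟩ := (leap_spec (f := f) (m := m) (μ := μ) (S := S) v hx).2
    refine ⟨h1, h2, i + j + l, ?_⟩
    rw [e, ← Function.iterate_add_apply, ← Function.iterate_add_apply]

/-- The search takes `O(m)` rounds. -/
theorem exists_search (hκ : ∀ v, κ (f v) ≤ κ v) (hμ : 1 ≤ μ) (hm : 1 ≤ m) {x : ℕ} {v : V}
    (hx : x < κ v) (hQ : κ v - x ≤ μ * 2 ^ m) :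
    ∃ n ≤ 4 * m, ∃ r, Search f κ m μ S x v n r := by
  obtain ⟨d, hd⟩ := exists_dist (m := m) (S := S) hκ hμ hx
  obtain ⟨n, hn, r, hr⟩ := hd.search hκ hμ hm _ rfl (hd.le hκ hx hQ)
  have := Nat.mod_lt (dep f κ m μ S v) hm
  exact ⟨n, by omega, r, hr⟩

/-- If the key drops from above `x` by at least `μ` in one step, then the search ends at most `2 * m`
steps before. -/
theorem Search.near (hκ : ∀ v, κ (f v) ≤ κ v) {x n J : ℕ} {v r : V}
    (h : Search f κ m μ S x v n r) (hx : x < κ v) (hJ : x < κ (f^[J] v))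
    (hJ' : κ (f^[J + 1] v) ≤ x) (hd : κ (f^[J + 1] v) + μ ≤ κ (f^[J] v))
    (hS : ∀ i, i + m ≤ J + 1 → ∃ j < m, S (f^[i + j] v)) :
    ∃ j < 2 * m, f^[J] v = f^[j] r := by
  obtain ⟨hr, hna, i, rfl⟩ := h.spec hx
  have hiJ : i ≤ J := by
    by_contra hlt
    have := key_iterate_anti hκ (show J + 1 ≤ i by omega) v
    omega
  refine ⟨J - i, ?_, by rw [← Function.iterate_add_apply, Nat.sub_add_cancel hiJ]⟩
  by_contra hge
  -- Take a sampled node among the `m` nodes that end with node `J`. The drop at `J` lies within its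
  -- next `m` steps, so it is a stop. It is at least `m` steps from the result, so the hop from
  -- there does not pass it and still has a key above `x`.
  obtain ⟨j, hj, hs⟩ := hS (J + 1 - m) (by omega)
  set t := J + 1 - m + j with ht
  have hst : Stop f κ m μ S (f^[t - i] (f^[i] v)) := by
    rw [← Function.iterate_add_apply, Nat.sub_add_cancel (by omega)]
    refine ⟨hs, ?_⟩
    rw [← Function.iterate_add_apply]
    have h1 := key_iterate_anti hκ (show J + 1 ≤ m + t by omega) v
    have h2 := key_iterate_anti hκ (show t ≤ J by omega) v
    omega
  obtain ⟨l, hl, e⟩ := hop_of_stop (by omega) hst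
  refine hna ⟨_, e, ?_⟩
  rw [← Function.iterate_add_apply]
  have := key_iterate_anti hκ (show l + i ≤ J by omega) v
  omega

end JumpChain

/-! ### Sampling -/

/-- The right-hand side is the exact value of the sum, which makes the induction work. -/
theorem sum_range_succ_mul_half_pow_le (K : ℕ) :
    ∑ k ∈ Finset.range K, ((k : ℚ) + 1) * (1 / 2) ^ k ≤ 4 - (2 * K + 4) * (1 / 2) ^ K := by
  induction K with
  | zero => norm_num
  | succ K ih =>
    rw [Finset.sum_range_succ, pow_succ]
    push_cast
    linarith

/-- In each of the forests given by the depths `d k`, sample about every `2 ^ k`-th node. -/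
theorem exists_sampling_rank {Z : Type} [Fintype Z] (d : ℕ → Z → ℕ) (g : ℕ → Z → Z)
    (hd : ∀ k j z, d k ((g k)^[j] z) = d k z - j) :
    ∃ rank : Z → ℕ, ∑ z, (rank z + 1) ≤ 4 * Fintype.card Z ∧
      ∀ k z, 2 ^ k ≤ d k z + 1 → ∃ j < 2 ^ k, k ≤ rank ((g k)^[j] z) := by
  classical
  have hc : ∀ k, ∃ c < 2 ^ k,
      ((Finset.univ.filter fun z => d k z % 2 ^ k = c).card : ℚ) ≤
        Fintype.card Z * (1 / 2) ^ k := by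
    intro k
    -- Among the `2 ^ k` residue classes of depths, one has at most the average size.
    obtain ⟨c, hc, h⟩ := Finset.exists_card_fiber_le_of_card_le_nsmul
      (s := (Finset.univ : Finset Z)) (t := Finset.range (2 ^ k)) (f := fun z => d k z % 2 ^ k)
      (b := (Fintype.card Z * (1 / 2) ^ k : ℚ)) (by simp) (by
        rw [Finset.card_range, Finset.card_univ, nsmul_eq_mul]
        push_cast
        rw [mul_left_comm, ← mul_pow]
        norm_num)
    exact ⟨c, Finset.mem_range.1 hc, h⟩
  choose c hc hcard using hc
  let M : ℕ → Finset Z := fun k => Finset.univ.filter fun z => d k z % 2 ^ k = c k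
  have hM : ∀ k z, z ∈ M k ↔ d k z % 2 ^ k = c k := fun k z => by simp [M]
  let K := Fintype.card Z
  have hlt : ∀ k z, z ∈ M k → k < K := by
    intro k z hz
    have h1 : (1 : ℚ) ≤ (M k).card := by exact_mod_cast Finset.card_pos.2 ⟨z, hz⟩
    have h2 : (1 : ℚ) ≤ K * (1 / 2) ^ k := h1.trans (hcard k)
    rw [one_div, inv_pow, ← div_eq_mul_inv, one_le_div (by positivity)] at h2
    have h3 : 2 ^ k ≤ K := by exact_mod_cast h2
    exact lt_of_lt_of_le Nat.lt_two_pow_self h3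
  let A : Z → Finset ℕ := fun z => (Finset.range K).filter fun k => z ∈ M k
  have hA : ∀ k z, k ∈ A z ↔ z ∈ M k := fun k z => by
    simp only [A, Finset.mem_filter, Finset.mem_range]
    exact ⟨fun h => h.2, fun h => ⟨hlt k z h, h⟩⟩
  have h0 : ∀ z, 0 ∈ A z := fun z => by
    rw [hA, hM]
    have := hc 0
    simp only [pow_zero] at this ⊢
    omega
  -- The rank is the largest scale at which `z` is chosen. Its entries at all smaller scales are
  -- charged to that choice, so a member of `M k` pays at most `k + 1`.
  refine ⟨fun z => (A z).sup id, ?_, ?_⟩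
  · have h1 : ∀ z, (A z).sup id + 1 ≤ ∑ k ∈ Finset.range K, if z ∈ M k then k + 1 else 0 := by
      intro z
      obtain ⟨k, hk, e⟩ := Finset.exists_mem_eq_sup (A z) ⟨0, h0 z⟩ id
      rw [e, ← Finset.sum_filter]
      exact Finset.single_le_sum (f := fun k => k + 1) (fun _ _ => Nat.zero_le _) hk
    have h2 : ∑ z, ((A z).sup id + 1) ≤ ∑ k ∈ Finset.range K, (k + 1) * (M k).card := by
      refine (Finset.sum_le_sum fun z _ => h1 z).trans ?_
      rw [Finset.sum_comm]
      refine Finset.sum_le_sum fun k _ => ?_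
      rw [← Finset.sum_filter, Finset.sum_const, smul_eq_mul, Nat.mul_comm]
      simp
    have h3 : ((∑ k ∈ Finset.range K, (k + 1) * (M k).card : ℕ) : ℚ) ≤ 4 * K := by
      push_cast
      calc ∑ k ∈ Finset.range K, ((k : ℚ) + 1) * (M k).card
          ≤ ∑ k ∈ Finset.range K, K * (((k : ℚ) + 1) * (1 / 2) ^ k) := by
            refine Finset.sum_le_sum fun k _ => ?_
            rw [mul_left_comm]
            exact mul_le_mul_of_nonneg_left (hcard k) (by positivity)
        _ ≤ K * 4 := by
            rw [← Finset.mul_sum]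
            refine mul_le_mul_of_nonneg_left ?_ (by positivity)
            refine (sum_range_succ_mul_half_pow_le K).trans ?_
            have : (0 : ℚ) ≤ (2 * K + 4) * (1 / 2) ^ K := by positivity
            linarith
        _ = 4 * K := mul_comm _ _
    exact h2.trans (by exact_mod_cast h3)
  · intro k z hz
    have hck := hc k
    -- So many steps lead to a depth congruent to `c k`; the subtraction is not truncated because `c
    -- k ≤ 2 ^ k - 1 ≤ d k z`.
    refine ⟨(d k z - c k) % 2 ^ k, Nat.mod_lt _ (by positivity), ?_⟩
    have : k ∈ A ((g k)^[(d k z - c k) % 2 ^ k] z) := by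
      rw [hA, hM, hd]
      have h1 := Nat.div_add_mod (d k z - c k) (2 ^ k)
      have h2 : d k z - (d k z - c k) % 2 ^ k = c k + 2 ^ k * ((d k z - c k) / 2 ^ k) := by omega
      rw [h2, Nat.add_mul_mod_self_left, Nat.mod_eq_of_lt hck]
    exact Finset.le_sup (f := id) this

/-- Contiguous storage for `size z` records for each `z`. -/
theorem exists_contiguous_layout {Z : Type} [Fintype Z] (size : Z → ℕ) :
    ∃ base : Z → ℕ, (∀ z k, k < size z → base z + k < ∑ z, size z) ∧
      ∀ z k z' k', k < size z → k' < size z' → base z + k = base z' + k' → z = z' ∧ k = k' := by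
  let e := Fintype.equivFin Z
  let s : Fin (Fintype.card Z) → ℕ := fun i => size (e.symm i)
  have hs : ∑ i, s i = ∑ z, size z := Equiv.sum_comp e.symm size
  have hval : ∀ z k, ∀ h : k < s (e z), ((finSigmaFinEquiv ⟨e z, ⟨k, h⟩⟩ : Fin (∑ i, s i)) : ℕ) =
      (∑ i : Fin (e z : ℕ), s (Fin.castLE (e z).2.le i)) + k := fun z k h => by
    rw [finSigmaFinEquiv_apply]
  have hse : ∀ z, s (e z) = size z := fun z => by simp [s]
  refine ⟨fun z => ∑ i : Fin (e z : ℕ), s (Fin.castLE (e z).2.le i), ?_, ?_⟩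
  · intro z k h
    rw [← hse] at h
    rw [← hval z k h, ← hs]
    exact Fin.is_lt _
  · intro z k z' k' h h' heq
    rw [← hse] at h h'
    simp only at heq
    rw [← hval z k h, ← hval z' k' h'] at heq
    have h1 := finSigmaFinEquiv.injective (Fin.ext heq)
    have h2 : e z = e z' := congrArg Sigma.fst h1
    obtain rfl := e.injective h2
    refine ⟨rfl, ?_⟩
    simpa using h1

/-! ### The data structure -/

namespace AccessGraph

variable {V : Type}

/-- The level threshold: fixed by the scale in the wide mode `false`, and the level of the node in
the narrow mode `true`. -/
def thr (G : AccessGraph V) (b : Bool) (k : ℕ) (v : V) : ℕ := if b then G.lev v else 2 ^ k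

/-- The minimal weight of the exits that are found at scale `k`. -/
def mu (G : AccessGraph V) (b : Bool) (k : ℕ) (v : V) : ℕ :=
  if b then 2 ^ (G.lev v - 2 ^ k) else 1

/-- The hop from a node at scale `k`. -/
noncomputable def hopAt (G : AccessGraph V) (rank : V × Bool → ℕ) (b : Bool) (k : ℕ) (v : V) :
    Option V :=
  JumpChain.hop (G.next (G.thr b k v)) (G.key (G.thr b k v)) (2 ^ k) (G.mu b k v)
    (fun u => k ≤ rank (u, b)) v

/-- The jump pointer of a node at scale `k`. -/
noncomputable def jumpAt (G : AccessGraph V) (rank : V × Bool → ℕ) (b : Bool) (k : ℕ) (v : V) :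
    Option V :=
  JumpChain.jump (G.next (G.thr b k v)) (G.key (G.thr b k v)) (2 ^ k) (G.mu b k v)
    (fun u => k ≤ rank (u, b)) v

theorem rank_of_hopAt {G : AccessGraph V} {rank : V × Bool → ℕ} {b : Bool} {k : ℕ} {v u : V}
    (h : G.hopAt rank b k v = some u) : k ≤ rank (u, b) :=
  (JumpChain.hop_eq_some h).2.1

theorem rank_of_jumpAt {G : AccessGraph V} {rank : V × Bool → ℕ} {b : Bool} {k : ℕ} {v u : V}
    (h : G.jumpAt rank b k v = some u) : k ≤ rank (u, b) := by
  unfold jumpAt JumpChain.jump at h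
  generalize hL : 2 * 2 ^ k * 2 ^ _ = L at h
  -- A jump consists of at least one hop, so its target is a stop and has an entry at this scale.
  have : 0 < L := by rw [← hL]; positivity
  obtain ⟨t, rfl⟩ := Nat.exists_eq_add_of_le' this
  exact (JumpChain.stop_of_chain h).1

/-- The address of an optional entry. -/
def optEntry (base : V × Bool → ℕ) (dummy : ℕ) (b : Bool) (k : ℕ) : Option V → ℕ
  | none => dummy
  | some u => base (u, b) + 8 * k

/-- The memory `D` stores the graph and its search structures: a record for each node and mode, and
an entry for each scale up to the rank. -/
structure Layout (G : AccessGraph V) (rank : V × Bool → ℕ) (D : List ℕ) (w : ℕ) where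
  slot : V × Bool → ℕ
  base : V × Bool → ℕ
  dummy : ℕ
  length_le : D.length ≤ 2 ^ w
  lt_word : ∀ x ∈ D, x < 2 ^ w
  len : ∀ v b, D[slot (v, b) + 0]? = some (G.len v)
  lev : ∀ v b, D[slot (v, b) + 1]? = some (G.lev v)
  left : ∀ v b, D[slot (v, b) + 2]? = some (slot (G.left v, b))
  right : ∀ v b, D[slot (v, b) + 3]? = some (slot (G.right v, b))
  rank' : ∀ v b, D[slot (v, b) + 4]? = some (rank (v, b))
  base' : ∀ v b, D[slot (v, b) + 5]? = some (base (v, b))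
  mirror : ∀ v b, D[slot (v, b) + 6]? = some (slot (G.mirror v, b))
  twin : ∀ v, D[slot (v, false) + 7]? = some (slot (v, true))
  char : ∀ v, D[slot (v, true) + 7]? = some (G.char v 1)
  key : ∀ v b k, k ≤ rank (v, b) → D[base (v, b) + 8 * k + 0]? = some (G.key (G.thr b k v) v)
  node : ∀ v b k, k ≤ rank (v, b) → D[base (v, b) + 8 * k + 1]? = some (slot (v, b))
  hop : ∀ v b k, k ≤ rank (v, b) →
    D[base (v, b) + 8 * k + 2]? = some (optEntry base dummy b k (G.hopAt rank b k v))
  jump : ∀ v b k, k ≤ rank (v, b) →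
    D[base (v, b) + 8 * k + 3]? = some (optEntry base dummy b k (G.jumpAt rank b k v))
  root : ∀ v b k, k ≤ rank (v, b) →
    D[base (v, b) + 8 * k + 4]? = some (slot (G.root (G.thr b k v) v, b))
  key_dummy : D[dummy + 0]? = some 0

/-- Records of eight words at given places. -/
theorem exists_records {I : Type} (loc : I → ℕ) (hloc : Function.Injective loc) {B : ℕ}
    (hB : ∀ i, loc i < B) (rec : I → ℕ → ℕ) {W : ℕ} (hW : ∀ i f, rec i f < W) (hW0 : 0 < W) :
    ∃ D : List ℕ, D.length = 8 * B ∧ (∀ x ∈ D, x < W) ∧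
      ∀ i f, f < 8 → D[8 * loc i + f]? = some (rec i f) := by
  refine ⟨List.ofFn fun a : Fin (8 * B) =>
    Function.extend loc rec (fun _ _ => 0) (a / 8) (a % 8), by simp, ?_, ?_⟩
  · intro x hx
    obtain ⟨a, rfl⟩ := (List.mem_ofFn' _ _).1 hx
    by_cases h : ∃ i, loc i = a / 8
    · obtain ⟨i, hi⟩ := h
      simp only [← hi, hloc.extend_apply]
      exact hW _ _
    · simp only [Function.extend_apply' _ _ _ h]
      exact hW0
  · intro i f hf
    have := hB i
    rw [List.getElem?_ofFn, dif_pos (by omega)]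
    simp only [show (8 * loc i + f) / 8 = loc i by omega, show (8 * loc i + f) % 8 = f by omega,
      hloc.extend_apply]

/-- All records have eight words: `m` places for node records, one dummy, and `rank z + 1`
consecutive entries for each `z`, so the address of an entry is computed from its scale. -/
theorem exists_layout [Fintype V] (G : AccessGraph V) (rank : V × Bool → ℕ) {w m : ℕ}
    (idx : V × Bool → ℕ) (hidx : Function.Injective idx) (hm : ∀ z, idx z < m)
    (hlen : ∀ v, G.len v < 2 ^ w) (hchar : ∀ v, G.char v 1 < 2 ^ w)
    (hB : 8 * (m + 1 + ∑ z, (rank z + 1)) ≤ 2 ^ w) :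
    ∃ D : List ℕ, D.length = 8 * (m + 1 + ∑ z, (rank z + 1)) ∧
      ∃ L : Layout G rank D w, ∀ z, L.slot z = 8 * idx z := by
  obtain ⟨base, hb, hinj⟩ := exists_contiguous_layout fun z : V × Bool => rank z + 1
  set N := ∑ z : V × Bool, (rank z + 1) with hN
  have hrank : ∀ z, rank z < N := fun z => by have := hb z (rank z) (by omega); omega
  have hkey : ∀ T v, G.key T v < 2 ^ w := fun T v => by
    have := G.key_add_len_root_le (T := T) v
    have := hlen v
    omega
  have hlev : ∀ v, G.lev v < 2 ^ w := fun v => (Nat.log_le_self _ _).trans_lt (hlen v)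
  let I := (V × Bool) ⊕ Unit ⊕ {p : (V × Bool) × ℕ // p.2 ≤ rank p.1}
  let loc : I → ℕ
    | .inl z => idx z
    | .inr (.inl _) => m
    | .inr (.inr p) => m + 1 + base p.1.1 + p.1.2
  have hloc : Function.Injective loc := by
    rintro (z | u | ⟨⟨z, k⟩, hk⟩) (z' | u' | ⟨⟨z', k'⟩, hk'⟩) h <;> simp only [loc] at h
    · rw [hidx h]
    · have := hm z; omega
    · have := hm z; omega
    · have := hm z'; omega
    · rfl
    · omega
    · have := hm z'; omega
    · omega
    · obtain ⟨rfl, rfl⟩ := hinj z k z' k' (Nat.lt_succ_of_le hk) (Nat.lt_succ_of_le hk') (by omega)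
      rfl
  have hlocB : ∀ i, loc i < m + 1 + N := by
    rintro (z | u | ⟨⟨z, k⟩, hk⟩) <;> simp only [loc]
    · have := hm z; omega
    · omega
    · have := hb z k (Nat.lt_succ_of_le hk); omega
  let bs : V × Bool → ℕ := fun z => 8 * (m + 1 + base z)
  let rec' : I → ℕ → ℕ
    | .inl (v, b), f =>
      if f = 0 then G.len v else if f = 1 then G.lev v else if f = 2 then 8 * idx (G.left v, b)
      else if f = 3 then 8 * idx (G.right v, b) else if f = 4 then rank (v, b)
      else if f = 5 then bs (v, b) else if f = 6 then 8 * idx (G.mirror v, b)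
      else if b then G.char v 1 else 8 * idx (v, true)
    | .inr (.inl _), _ => 0
    | .inr (.inr ⟨((v, b), k), _⟩), f =>
      if f = 0 then G.key (G.thr b k v) v else if f = 1 then 8 * idx (v, b)
      else if f = 2 then optEntry bs (8 * m) b k (G.hopAt rank b k v)
      else if f = 3 then optEntry bs (8 * m) b k (G.jumpAt rank b k v)
      else if f = 4 then 8 * idx (G.root (G.thr b k v) v, b) else 0
  have hidxw : ∀ z, 8 * idx z < 2 ^ w := fun z => by have := hm z; omega
  have hopt : ∀ b k (o : Option V), (∀ u, o = some u → k ≤ rank (u, b)) →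
      optEntry bs (8 * m) b k o < 2 ^ w := by
    rintro b k (_ | u) ho
    · simp only [optEntry]; omega
    · have := hb (u, b) k (Nat.lt_succ_of_le (ho u rfl))
      simp only [optEntry, bs]; omega
  have hpos : 0 < 2 ^ w := by positivity
  have hW : ∀ i f, rec' i f < 2 ^ w := by
    rintro (⟨v, b⟩ | u | ⟨⟨⟨v, b⟩, k⟩, hk⟩) f <;> simp only [rec']
    · have h1 := hb (v, b) 0 (by omega)
      have h2 := hrank (v, b)
      have h3 : bs (v, b) < 2 ^ w := by simp only [bs]; omega
      have h4 := hlen v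
      have h5 := hlev v
      have h6 := hidxw
      have h7 := hchar v
      split_ifs <;> first | assumption | exact h6 _ | omega
    · exact hpos
    · split_ifs
      · exact hkey _ _
      · exact hidxw _
      · exact hopt _ _ _ fun u hu => rank_of_hopAt hu
      · exact hopt _ _ _ fun u hu => rank_of_jumpAt hu
      · exact hidxw _
      · exact hpos
  obtain ⟨D, hD, hDw, hget⟩ := exists_records loc hloc hlocB rec' hW hpos
  have hslot : ∀ v b f, f < 8 → D[8 * idx (v, b) + f]? = some (rec' (.inl (v, b)) f) :=
    fun v b f hf => hget (.inl (v, b)) f hf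
  have hent : ∀ v b k f, (hk : k ≤ rank (v, b)) → f < 8 →
      D[bs (v, b) + 8 * k + f]? = some (rec' (.inr (.inr ⟨((v, b), k), hk⟩)) f) := by
    intro v b k f hk hf
    have h := hget (.inr (.inr ⟨((v, b), k), hk⟩)) f hf
    have e : 8 * loc (.inr (.inr ⟨((v, b), k), hk⟩)) = bs (v, b) + 8 * k := by
      simp only [loc, bs]; ring
    rwa [e] at h
  exact ⟨D, hD,
    { slot := fun z => 8 * idx z
      base := bs
      dummy := 8 * m
      length_le := hD.le.trans hB
      lt_word := hDw
      len := fun v b => hslot v b 0 (by norm_num)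
      lev := fun v b => hslot v b 1 (by norm_num)
      left := fun v b => hslot v b 2 (by norm_num)
      right := fun v b => hslot v b 3 (by norm_num)
      rank' := fun v b => hslot v b 4 (by norm_num)
      base' := fun v b => hslot v b 5 (by norm_num)
      mirror := fun v b => hslot v b 6 (by norm_num)
      twin := fun v => hslot v false 7 (by norm_num)
      char := fun v => hslot v true 7 (by norm_num)
      key := fun v b k hk => hent v b k 0 hk (by norm_num)
      node := fun v b k hk => hent v b k 1 hk (by norm_num)
      hop := fun v b k hk => hent v b k 2 hk (by norm_num)
      jump := fun v b k hk => hent v b k 3 hk (by norm_num)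
      root := fun v b k hk => hent v b k 4 hk (by norm_num)
      key_dummy := hget (.inr (.inl ())) 0 (by norm_num) }, fun _ => rfl⟩

end AccessGraph

/-! ### The query program -/

namespace AccessGraph

open WordRAM

variable {V : Type} {G : AccessGraph V} {rank : V × Bool → ℕ} {D : List ℕ} {w : ℕ}

theorem Layout.value_lt (L : Layout G rank D w) {a z : ℕ} (h : D[a]? = some z) : z < 2 ^ w :=
  L.lt_word z (List.mem_of_getElem? h)

theorem Layout.addr_lt (L : Layout G rank D w) {a z : ℕ} (h : D[a]? = some z) : a < 2 ^ w :=
  lt_of_lt_of_le (List.getElem?_eq_some_iff.1 h).1 L.length_le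

/-- Threshold and minimal weight are constant along a path, so the pointers stored with different
nodes fit together to one chain. -/
theorem thr_iterate {b : Bool} {k T : ℕ} {v : V} (h : G.thr b k v = T) (j : ℕ) :
    G.thr b k ((G.next T)^[j] v) = T := by
  unfold thr at h ⊢
  cases b with
  | false => exact h
  | true =>
    simp only [if_true] at h ⊢
    subst h
    exact lev_iterate_eq j

theorem mu_iterate {b : Bool} {k T : ℕ} {v : V} (h : G.thr b k v = T) (j : ℕ) :
    G.mu b k ((G.next T)^[j] v) = G.mu b k v := by
  have h' := thr_iterate h j
  unfold thr at h h'
  unfold mu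
  cases b with
  | false => rfl
  | true =>
    simp only [if_true] at h h' ⊢
    rw [h, h']

/-- The current node and position are in the registers `0` and `1`. -/
def Layout.At (L : Layout G rank D w) (b : Bool) (ρ : Regs) (v : V) (i : ℕ) : Prop :=
  ρ 0 = L.slot (v, b) ∧ ρ 1 = i ∧ 1 ≤ i ∧ i ≤ G.len v

/-- The registers from `2` to `n - 1` are unchanged. -/
def Frame (n : ℕ) (ρ ρ' : Regs) : Prop := ∀ r, 2 ≤ r → r < n → ρ' r = ρ r

theorem Frame.trans {n : ℕ} {ρ ρ' ρ'' : Regs} (h : Frame n ρ ρ') (h' : Frame n ρ' ρ'') :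
    Frame n ρ ρ'' := fun r h1 h2 => (h' r h1 h2).trans (h r h1 h2)

theorem Frame.mono {n m : ℕ} {ρ ρ' : Regs} (h : Frame n ρ ρ') (hm : m ≤ n) : Frame m ρ ρ' :=
  fun r h1 h2 => h r h1 (by omega)

theorem Frame.rfl {n : ℕ} {ρ : Regs} : Frame n ρ ρ := fun _ _ _ => Eq.refl _

theorem Frame.update {n d x : ℕ} {ρ ρ' : Regs} (hd : d < 2 ∨ n ≤ d) (h : Frame n ρ ρ') :
    Frame n ρ (Function.update ρ' d x) := fun r h1 h2 => by
  rw [Function.update_of_ne (by omega)]; exact h r h1 h2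

/-- One step of the descent. -/
def descendCmd : Cmd :=
  .seq (.field 10 0 2) <| .seq (.field 11 10 0) <|
  .ite 11 1 (.seq (.op .sub 1 1 11) (.seq (.field 10 0 3) (.mov 0 10))) (.mov 0 10)

theorem Layout.descend (L : Layout G rank D w) {b : Bool} {ρ : Regs} {v : V} {i : ℕ}
    (h : L.At b ρ v i) (h2 : 2 ≤ G.len v) :
    Post D w descendCmd ρ fun t ρ' => t ≤ 12 ∧
      L.At b ρ' (G.desc (v, i)).1 (G.desc (v, i)).2 ∧ Frame 10 ρ ρ' := by
  obtain ⟨h0, h1, hi, hi'⟩ := h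
  have hd := (desc_spec (s := (v, i)) h2 hi hi').2
  have hw : i < 2 ^ w := hi'.trans_lt (L.value_lt (L.len v b))
  unfold descendCmd
  refine .seq (.field (by decide) L.length_le (h0 ▸ L.left v b) (.seq (.field (by decide)
    L.length_le (by simpa [Function.update_apply] using L.len (G.left v) b) (.ite ?_ ?_))))
  · intro hlt
    simp only [Function.update_apply] at hlt
    simp [h1] at hlt
    refine .seq (.sub (z := i - G.len (G.left v)) (by simp [h1]; omega) (by simpa [h1])
      (.seq (.field (z := L.slot (G.right v, b)) (by decide) L.length_le
        (by simpa [Function.update_apply, h0] using L.right v b) (.mov ?_))))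
    refine ⟨by norm_num, ?_, ?_⟩
    · have e : G.desc (v, i) = (G.right v, i - G.len (G.left v)) := by
        unfold desc; rw [if_neg (by simpa using hlt)]
      rw [e] at hd ⊢
      exact ⟨by simp, by simp, hd⟩
    · iterate 5 refine Frame.update (by omega) ?_
      exact .rfl
  · intro hlt
    simp only [Function.update_apply] at hlt
    simp [h1] at hlt
    refine .mov ⟨by norm_num, ?_, ?_⟩
    · have e : G.desc (v, i) = (G.left v, i) := by
        unfold desc; rw [if_pos (by simpa using hlt)]
      rw [e] at hd ⊢
      exact ⟨by simp, by simp [h1], hd⟩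
    · iterate 3 refine Frame.update (by omega) ?_
      exact .rfl

/-- Descend until the level is below the threshold or the node is sampled. -/
def approachCmd : Cmd :=
  .loop (.seq (.field 10 0 1) <| .seq (.field 11 0 4) <| .ite 10 2 (.mov 11 3) (.mov 11 11)) 11 3
    descendCmd

/-- A loop tests a single inequality. The conjunction is encoded by overwriting the rank with the
scale when the level is too low, which makes the test fail. -/
theorem Layout.approach_guard (L : Layout G rank D w) {b : Bool} {ρ : Regs} {v : V} {i T k : ℕ}
    (h : L.At b ρ v i) (h2 : ρ 2 = T) (h3 : ρ 3 = k) :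
    Post D w (.seq (.field 10 0 1) <| .seq (.field 11 0 4) <|
      .ite 10 2 (.mov 11 3) (.mov 11 11)) ρ fun t ρ' => t ≤ 9 ∧ L.At b ρ' v i ∧
        Frame 10 ρ ρ' ∧ (ρ' 11 < ρ' 3 ↔ T ≤ G.lev v ∧ rank (v, b) < k) := by
  obtain ⟨h0, h1, hi, hi'⟩ := h
  refine .seq (.field (by decide) L.length_le (h0 ▸ L.lev v b) (.seq (.field (by decide)
    L.length_le (by simpa [Function.update_apply, h0] using L.rank' v b) (.ite ?_ ?_))))
  · intro hlt
    simp only [Function.update_apply] at hlt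
    simp [h2] at hlt
    refine .mov ⟨by norm_num, ⟨by simp [h0],
      by simp [h1], hi, hi'⟩, ?_, ?_⟩
    · iterate 3 refine Frame.update (by omega) ?_
      exact .rfl
    · simp [not_le.2 hlt]
  · intro hlt
    simp only [Function.update_apply] at hlt
    simp [h2] at hlt
    refine .mov ⟨by norm_num, ⟨by simp [h0],
      by simp [h1], hi, hi'⟩, ?_, ?_⟩
    · iterate 3 refine Frame.update (by omega) ?_
      exact .rfl
    · simp [hlt, h3]

theorem Layout.approach_low (L : Layout G rank D w) {b : Bool} {T k : ℕ} {ρ : Regs} {v : V}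
    {i : ℕ} (h : L.At b ρ v i) (h2 : ρ 2 = T) (h3 : ρ 3 = k) (hv : G.lev v < T) :
    Post D w approachCmd ρ fun t ρ' => t ≤ 11 ∧ Frame 10 ρ ρ' ∧ L.At b ρ' v i := by
  refine .loop ((L.approach_guard h h2 h3).mono ?_)
  rintro t ρ₁ ⟨ht, ha, hf, hiff⟩
  exact ⟨fun _ => ⟨by omega, hf, ha⟩, fun hlt => absurd (hiff.1 hlt).1 (not_le.2 hv)⟩

theorem Layout.approach (L : Layout G rank D w) {b : Bool} {T k : ℕ} (hT : 1 ≤ T) (n : ℕ)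
    {ρ : Regs} {v : V} {i : ℕ} (h : L.At b ρ v i) (h2 : ρ 2 = T) (h3 : ρ 3 = k)
    (hg : G.Good T v i)
    (hn : (∃ j ≤ n, k ≤ rank ((G.next T)^[j] v, b)) ∨ G.depth T v ≤ n) :
    Post D w approachCmd ρ fun t ρ' => t ≤ 23 * (n + 2) ∧ Frame 10 ρ ρ' ∧ ∃ v' i',
      L.At b ρ' v' i' ∧ G.drop T (v', i') = G.drop T (v, i) ∧ (G.lev v' < T ∨
        (G.Good T v' i' ∧ k ≤ rank (v', b) ∧ (∃ j, v' = (G.next T)^[j] v) ∧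
          i' + G.key T v = i + G.key T v')) := by
  induction n generalizing ρ v i with
  | zero => ?_
  | succ n ih => ?_
  -- Both cases run the guard and one step of the descent. They differ only if this step stays on
  -- the path, which is impossible in the base case.
  all_goals
    refine .loop ((L.approach_guard h h2 h3).mono ?_)
    rintro t ρ₁ ⟨ht, ha, hf, hiff⟩
    refine ⟨fun hlt => ⟨by omega, hf, v, i, ha, rfl, .inr ⟨hg, ?_, ⟨0, rfl⟩, rfl⟩⟩, fun hlt => ?_⟩
    · exact not_lt.1 fun h' => hlt (hiff.2 ⟨hg.1, h'⟩)
    have hr := (hiff.1 hlt).2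
    refine (L.descend ha (G.two_le_len hT hg.1)).mono ?_
    rintro t' ρ₂ ⟨ht', ha', hf'⟩
    replace hf' := hf.trans hf'
    have e2 := h2 ▸ hf' 2 le_rfl (by norm_num)
    have e3 := h3 ▸ hf' 3 (by norm_num) (by norm_num)
    have hd := drop_desc (s := (v, i)) hT hg.1
    rcases hg.desc_cases hT with ⟨hi, hw, e, hg2⟩ | hlev
    rotate_left
    · refine (L.approach_low ha' e2 e3 hlev).mono ?_
      rintro t'' ρ₃ ⟨ht'', hf'', ha''⟩
      exact ⟨by omega, hf'.trans hf'', _, _, ha'', hd, .inl hlev⟩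
  · rcases hn with ⟨j, hj, hk⟩ | hn
    · obtain rfl : j = 0 := by omega
      exact absurd hk (not_le.2 hr)
    · exact absurd (inner_iff_depth_pos.1 hi) (by omega)
  · rw [e] at ha' hd
    have hn' : (∃ j ≤ n, k ≤ rank ((G.next T)^[j] (G.next T v), b)) ∨
        G.depth T (G.next T v) ≤ n := by
      rcases hn with ⟨j, hj, hk⟩ | hn
      · cases j with
        | zero => exact absurd hk (not_le.2 hr)
        | succ j => exact .inl ⟨j, by omega, hk⟩
      · right; rw [depth_next]; omega
    refine (ih ha' e2 e3 hg2 hn').mono ?_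
    rintro t'' ρ₃ ⟨ht'', hf'', v', i', ha'', hd', hc⟩
    refine ⟨by omega, hf'.trans hf'', v', i', ha'', hd'.trans hd, hc.imp id ?_⟩
    rintro ⟨hg3, hk, ⟨j, hj⟩, hkey⟩
    refine ⟨hg3, hk, ⟨j + 1, hj⟩, ?_⟩
    have := G.key_next (T := T) (v := v)
    simp only at hkey
    omega

theorem optEntry_some {base : V × Bool → ℕ} {dummy : ℕ} {b : Bool} {k : ℕ} {u : V} :
    optEntry base dummy b k (some u) = base (u, b) + 8 * k := rfl

/-- A missing pointer leads to the dummy with key `0`, which exceeds no bound, so the program needs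
no test for it. -/
theorem Layout.key_optEntry (L : Layout G rank D w) {b : Bool} {k T : ℕ} {o : Option V}
    (h : ∀ u, o = some u → k ≤ rank (u, b) ∧ G.thr b k u = T) :
    D[optEntry L.base L.dummy b k o + 0]? = some (o.elim 0 (G.key T)) := by
  cases o with
  | none => exact L.key_dummy
  | some u =>
    obtain ⟨h1, rfl⟩ := h u rfl
    exact L.key u b k h1

theorem above_iff {κ : V → ℕ} {x : ℕ} {o : Option V} :
    JumpChain.Above κ x o ↔ x < o.elim 0 κ := by
  cases o with
  | none => simp [JumpChain.Above]
  | some u => simp [JumpChain.Above]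

/-- One round of the search: take the jump pointer if possible, and look at the hop. -/
def leapCmd : Cmd :=
  .seq (.field 10 7 3) <| .seq (.field 11 10 0) <| .seq (.ite 8 11 (.mov 7 10) (.mov 10 10)) <|
  .seq (.field 11 7 2) (.field 12 11 0)

/-- The search for the last entry whose key exceeds register `8`. -/
def searchCmd : Cmd := .loop leapCmd 8 12 (.mov 7 11)

/-- Register `7` holds the address of the entry of `v` at scale `k`, in the forest with threshold
`T`. -/
def Layout.AtEntry (L : Layout G rank D w) (b : Bool) (k T μ : ℕ) (ρ : Regs) (v : V) : Prop :=
  ρ 7 = L.base (v, b) + 8 * k ∧ k ≤ rank (v, b) ∧ G.thr b k v = T ∧ G.mu b k v = μ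

theorem Layout.leap (L : Layout G rank D w) {b : Bool} {k T μ x : ℕ} {ρ : Regs} {v : V}
    (h : L.AtEntry b k T μ ρ v) (h8 : ρ 8 = x) (hx : x < G.key T v) :
    let u := JumpChain.leap (G.next T) (G.key T) (2 ^ k) μ (fun u => k ≤ rank (u, b)) x v
    let o := JumpChain.hop (G.next T) (G.key T) (2 ^ k) μ (fun u => k ≤ rank (u, b)) u
    Post D w leapCmd ρ fun t ρ' => t ≤ 15 ∧ L.AtEntry b k T μ ρ' u ∧ Frame 7 ρ ρ' ∧
      ρ' 0 = ρ 0 ∧ ρ' 1 = ρ 1 ∧ ρ' 8 = x ∧ ρ' 11 = optEntry L.base L.dummy b k o ∧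
      ρ' 12 = o.elim 0 (G.key T) ∧
      ∀ z, o = some z → k ≤ rank (z, b) ∧ G.thr b k z = T ∧ G.mu b k z = μ := by
  intro u o
  obtain ⟨h7, hk, rfl, rfl⟩ := h
  have hjump : ∀ z, G.jumpAt rank b k v = some z →
      k ≤ rank (z, b) ∧ G.thr b k z = G.thr b k v ∧ G.mu b k z = G.mu b k v := fun z hz => by
    obtain ⟨j, rfl⟩ := JumpChain.exists_iterate_of_chain _ hz
    exact ⟨rank_of_jumpAt hz, thr_iterate rfl j, mu_iterate rfl j⟩
  have hu : k ≤ rank (u, b) ∧ G.thr b k u = G.thr b k v ∧ G.mu b k u = G.mu b k v := by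
    by_cases hab : JumpChain.Above (G.key (G.thr b k v)) x (G.jumpAt rank b k v)
    · obtain ⟨z, hz, -⟩ := id hab
      have : u = z := by
        simp only [u, JumpChain.leap]
        unfold jumpAt at hz hab
        rw [if_pos hab, hz]; rfl
      rw [this]
      exact hjump z hz
    · have : u = v := by
        simp only [u, JumpChain.leap]
        exact if_neg hab
      rw [this]
      exact ⟨hk, rfl, rfl⟩
  have ho : o = G.hopAt rank b k u := by
    unfold hopAt
    rw [hu.2.1, hu.2.2]
  have hhop : ∀ z, o = some z →
      k ≤ rank (z, b) ∧ G.thr b k z = G.thr b k v ∧ G.mu b k z = G.mu b k v := fun z hz => by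
    have hz' := ho ▸ hz
    obtain ⟨⟨j, -, rfl⟩, -⟩ := JumpChain.hop_eq_some hz
    refine ⟨rank_of_hopAt hz', ?_, ?_⟩
    · exact thr_iterate hu.2.1 j
    · rw [mu_iterate hu.2.1 j, hu.2.2]
  have hD1 := L.jump v b k hk
  have hD2 := L.key_optEntry fun z hz => ⟨(hjump z hz).1, (hjump z hz).2.1⟩
  have hD3 := L.hop u b k hu.1
  rw [← ho] at hD3
  have hD4 := L.key_optEntry fun z hz => ⟨(hhop z hz).1, (hhop z hz).2.1⟩
  refine .seq (.field (by decide) L.length_le (by rw [h7]; exact hD1) (.seq (.field (by decide)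
    L.length_le (by simpa using hD2) (.seq (.ite ?_ ?_)))))
  · intro hlt
    simp [h8] at hlt
    have e : G.jumpAt rank b k v = some u := by
      obtain ⟨z, hz, hxz⟩ := above_iff.2 hlt
      rw [hz]
      have hab : JumpChain.Above (G.key (G.thr b k v)) x (G.jumpAt rank b k v) := ⟨z, hz, hxz⟩
      simp only [u, JumpChain.leap]
      unfold jumpAt at hz hab
      rw [if_pos hab, hz]; rfl
    refine .mov (.seq (.field (by decide) L.length_le (by simpa [e, optEntry_some] using hD3)
      (.field (by decide) L.length_le (by simpa using hD4) ⟨by norm_num,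
        ⟨by simp [e, optEntry_some], hu⟩, ?_, by simp, by simp, by simp [h8], by simp, by simp, hhop⟩)))
    iterate 5 refine Frame.update (by omega) ?_
    exact .rfl
  · intro hlt
    simp [h8] at hlt
    have e : u = v := by
      simp only [u, JumpChain.leap]
      rw [if_neg]
      exact fun h => not_lt.2 hlt (above_iff.1 h)
    refine .mov (.seq (.field (by decide) L.length_le (by simpa [e, h7] using hD3)
      (.field (by decide) L.length_le (by simpa using hD4) ⟨by norm_num,
        ⟨by simp [e, h7], hu⟩, ?_, by simp, by simp, by simp [h8], by simp, by simp, hhop⟩)))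
    iterate 5 refine Frame.update (by omega) ?_
    exact .rfl

theorem Layout.search (L : Layout G rank D w) {b : Bool} {k T μ x n : ℕ} {ρ : Regs} {v r : V}
    (hs : JumpChain.Search (G.next T) (G.key T) (2 ^ k) μ (fun u => k ≤ rank (u, b)) x v n r)
    (h : L.AtEntry b k T μ ρ v) (h8 : ρ 8 = x) (hx : x < G.key T v) :
    Post D w searchCmd ρ fun t ρ' => t ≤ 18 * n ∧ L.AtEntry b k T μ ρ' r ∧ Frame 7 ρ ρ' ∧
      ρ' 0 = ρ 0 ∧ ρ' 1 = ρ 1 ∧ ρ' 8 = x := by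
  induction hs generalizing ρ with
  | @done v hn =>
    refine .loop ((L.leap h h8 hx).mono ?_)
    rintro t ρ₁ ⟨ht, he, hf, e0, e1, e8, e11, e12, -⟩
    refine ⟨fun _ => ⟨by omega, he, hf, e0, e1, e8⟩, fun hlt => ?_⟩
    rw [e8, e12] at hlt
    exact absurd (above_iff.2 hlt) hn
  | @step v u r n hu hxu _ ih =>
    refine .loop ((L.leap h h8 hx).mono ?_)
    rintro t ρ₁ ⟨ht, he, hf, e0, e1, e8, e11, e12, hz⟩
    refine ⟨fun hlt => ?_, fun hlt => .mov ?_⟩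
    · rw [e8, e12, hu] at hlt
      exact absurd hxu hlt
    · rw [hu] at e11
      refine (ih (ρ := Function.update ρ₁ 7 (ρ₁ 11)) ⟨by simpa [optEntry_some] using e11, hz u hu⟩
        (by simpa using e8) hxu).mono ?_
      rintro t' ρ₂ ⟨ht', he', hf', e0', e1', e8'⟩
      simp at e0' e1'
      refine ⟨by omega, he', (hf.trans ?_).trans hf', by omega, by omega, e8'⟩
      exact Frame.update (by omega) .rfl

end AccessGraph

/-! ### One attempt at a fixed scale: sampled node, search, final descent. -/

namespace AccessGraph

open WordRAM

variable {V : Type} {G : AccessGraph V} {rank : V × Bool → ℕ} {D : List ℕ} {w : ℕ}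

/-- Less than `c + 1` steps of the descent lead below the level `T`. -/
def ExitsWithin (G : AccessGraph V) (T c : ℕ) (v : V) (i : ℕ) : Prop :=
  G.lev v < T ∨ (G.Good T v i ∧ ∃ j < c, G.key T v - G.key T ((G.next T)^[j] v) < i ∧
    G.lev (G.desc ((G.next T)^[j] v, i - (G.key T v - G.key T ((G.next T)^[j] v)))).1 < T)

theorem ExitsWithin.desc {T c : ℕ} {v : V} {i : ℕ} (hT : 1 ≤ T)
    (h : G.ExitsWithin T (c + 1) v i) :
    G.lev v < T ∨ G.ExitsWithin T c (G.desc (v, i)).1 (G.desc (v, i)).2 := by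
  rcases h with h | ⟨hg, j, hj, hk, hlev⟩
  · exact .inl h
  right
  rcases hg.desc_cases hT with ⟨hi, hw, e, hg2⟩ | hlev'
  · cases j with
    | zero => left; simpa using hlev
    | succ j =>
      right
      have h1 := G.key_next (T := T) (v := v)
      rw [Function.iterate_succ_apply] at hk hlev
      have h2 := key_iterate_le (G := G) (T := T) (Nat.zero_le j) (v := G.next T v)
      simp only [Function.iterate_zero, id] at h2
      rw [e]
      refine ⟨hg2, j, by omega, by simp only; omega, ?_⟩
      have e2 : i - G.wt T v - (G.key T (G.next T v) - G.key T ((G.next T)^[j] (G.next T v))) =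
          i - (G.key T v - G.key T ((G.next T)^[j] (G.next T v))) := by omega
      simp only [e2]
      exact hlev
  · exact .inl hlev'

/-- Descend below the threshold level, in at most as many steps as register `9` says. -/
def finishCmd : Cmd :=
  .loop (.seq (.field 10 0 1) <| .seq (.const 13 0) <| .ite 10 2 (.mov 11 13) (.mov 11 9)) 13 11
    (.seq descendCmd <| .seq (.const 13 1) (.op .sub 9 9 13))

theorem Layout.finish_guard (L : Layout G rank D w) {b : Bool} {ρ : Regs} {v : V} {i T c : ℕ}
    (h : L.At b ρ v i) (h2 : ρ 2 = T) (h9 : ρ 9 = c) :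
    Post D w (.seq (.field 10 0 1) <| .seq (.const 13 0) <|
      .ite 10 2 (.mov 11 13) (.mov 11 9)) ρ fun t ρ' => t ≤ 7 ∧ L.At b ρ' v i ∧
        Frame 10 ρ ρ' ∧ (ρ' 13 < ρ' 11 ↔ T ≤ G.lev v ∧ 0 < c) := by
  obtain ⟨h0, h1, hi, hi'⟩ := h
  refine .seq (.field (by decide) L.length_le (h0 ▸ L.lev v b) (.seq (.const (by positivity)
    (.ite ?_ ?_))))
  · intro hlt
    simp [h2] at hlt
    refine .mov ⟨by norm_num, ⟨by simp [h0], by simp [h1], hi, hi'⟩, ?_, ?_⟩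
    · iterate 3 refine Frame.update (by omega) ?_
      exact .rfl
    · simp [not_le.2 hlt]
  · intro hlt
    simp [h2] at hlt
    refine .mov ⟨by norm_num, ⟨by simp [h0], by simp [h1], hi, hi'⟩, ?_, ?_⟩
    · iterate 3 refine Frame.update (by omega) ?_
      exact .rfl
    · simp [hlt, h9]

theorem Layout.finish (L : Layout G rank D w) (hw : 1 < 2 ^ w) {b : Bool} {T : ℕ} (hT : 1 ≤ T)
    (c : ℕ) {ρ : Regs} {v : V} {i : ℕ} (h : L.At b ρ v i) (h2 : ρ 2 = T) (h9 : ρ 9 = c)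
    (hc : c < 2 ^ w) :
    Post D w finishCmd ρ fun t ρ' => t ≤ 23 * (c + 1) ∧ Frame 9 ρ ρ' ∧ ∃ v' i',
      L.At b ρ' v' i' ∧ G.drop T (v', i') = G.drop T (v, i) ∧
        (G.ExitsWithin T c v i → G.lev v' < T) := by
  unfold finishCmd
  induction c generalizing ρ v i with
  | zero =>
    refine .loop ((L.finish_guard h h2 h9).mono ?_)
    rintro t ρ₁ ⟨ht, ha, hf, hiff⟩
    refine ⟨fun _ => ⟨by omega, hf.mono (by norm_num), v, i, ha, rfl, ?_⟩, fun hlt => ?_⟩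
    · rintro (h | ⟨-, j, hj, -⟩)
      · exact h
      · omega
    · exact absurd (hiff.1 hlt).2 (by omega)
  | succ c ih =>
    refine .loop ((L.finish_guard h h2 h9).mono ?_)
    rintro t ρ₁ ⟨ht, ha, hf, hiff⟩
    refine ⟨fun hlt => ⟨by omega, hf.mono (by norm_num), v, i, ha, rfl, ?_⟩, fun hlt => ?_⟩
    · intro _
      by_contra hv
      exact hlt (hiff.2 ⟨not_lt.1 hv, by omega⟩)
    · have hv := (hiff.1 hlt).1
      refine .seq ((L.descend ha (G.two_le_len hT hv)).mono ?_)
      rintro t' ρ₂ ⟨ht', ha', hf'⟩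
      replace hf' := hf.trans hf'
      have e9 := h9 ▸ hf' 9 (by norm_num) (by norm_num)
      refine .seq (.const hw (.sub (z := c) (by simp [e9]; omega) (by simpa [e9]) ?_))
      have ha2 : L.At b (Function.update (Function.update ρ₂ 13 1) 9 c) (G.desc (v, i)).1
          (G.desc (v, i)).2 :=
        ⟨by simpa using ha'.1, by simpa using ha'.2.1, ha'.2.2⟩
      have hf2 : Frame 9 ρ (Function.update (Function.update ρ₂ 13 1) 9 c) :=
        .update (by omega) (.update (by omega) (hf'.mono (by norm_num)))
      refine (ih ha2 (h2 ▸ hf2 2 le_rfl (by norm_num)) (by simp) (by omega)).mono ?_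
      rintro t'' ρ₃ ⟨ht'', hf'', v', i', ha'', hd, hex⟩
      refine ⟨by omega, hf2.trans hf'', v', i', ha'', hd.trans (drop_desc hT hv), fun he => ?_⟩
      exact hex ((he.desc hT).resolve_left (not_lt.2 hv))

/-- From a sampled node, follow the search structure. -/
def lookupCmd : Cmd :=
  .seq (.field 10 0 1) <| .ite 10 2 (.mov 10 10) <|
  .seq (.field 7 0 5) <| .seq (.const 10 8) <| .seq (.op .mul 10 10 3) <|
  .seq (.op .add 7 7 10) <| .seq (.field 8 7 0) <|
  .ite 8 1 (.seq (.op .sub 1 1 8) <| .seq (.field 10 7 4) (.mov 0 10)) <|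
  .seq (.op .sub 8 8 1) <| .seq searchCmd <|
  .seq (.field 0 7 1) <| .seq (.field 10 7 0) (.op .sub 1 10 8)

/-- A position beyond the key moves to the root. Otherwise the search for the last key above `x =
key T v - i` ends at a node `r` of the path, with position `key T r - x`. The descent from there has
the same target in any case; only its shortness needs an exit of weight at least `μ`. -/
theorem Layout.lookup (L : Layout G rank D w) (hw : 8 < 2 ^ w) {b : Bool} {T μ k : ℕ} (hT : 1 ≤ T)
    (hμ : 1 ≤ μ) {ρ : Regs} {v : V} {i : ℕ} (h : L.At b ρ v i) (h2 : ρ 2 = T) (h3 : ρ 3 = k)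
    (hv : G.lev v < T ∨
      G.Good T v i ∧ k ≤ rank (v, b) ∧ G.thr b k v = T ∧ G.mu b k v = μ)
    (hS : ∀ u, G.thr b k u = T → 2 ^ k ≤ G.depth T u + 1 →
      ∃ j < 2 ^ k, k ≤ rank ((G.next T)^[j] u, b))
    (hQ : i ≤ G.key T v → i ≤ μ * 2 ^ 2 ^ k) :
    Post D w lookupCmd ρ fun t ρ' => t ≤ 100 * 2 ^ k ∧ Frame 7 ρ ρ' ∧ ∃ v' i',
      L.At b ρ' v' i' ∧ G.drop T (v', i') = G.drop T (v, i) ∧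
        (G.lev v < T ∨ G.key T v < i ∨ μ ≤ G.len (G.drop T (v, i)).1 →
          G.ExitsWithin T (2 * 2 ^ k) v' i') := by
  have hm : 1 ≤ 2 ^ k := Nat.one_le_two_pow
  have ha := h
  obtain ⟨h0, h1, hi, hi'⟩ := h
  refine .seq (.field (by decide) L.length_le (h0 ▸ L.lev v b) (.ite ?_ ?_))
  · intro hlt
    simp [h2] at hlt
    refine .mov ⟨by omega, ?_, v, i, ⟨by simp [h0], by simp [h1], hi, hi'⟩, rfl, fun _ => .inl hlt⟩
    iterate 2 refine Frame.update (by omega) ?_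
    exact .rfl
  · intro hlt
    simp [h2] at hlt
    obtain ⟨hg, hk, hthr, hmu⟩ := hv.resolve_left (not_lt.2 hlt)
    have hDk := L.key v b k hk
    rw [hthr] at hDk
    have haddr := L.addr_lt hDk
    have hDr := L.root v b k hk
    rw [hthr] at hDr
    have hDb := L.base' v b
    have hiw : i < 2 ^ w := hi'.trans_lt (L.value_lt (L.len v b))
    refine .seq (.field (z := L.base (v, b)) (by decide) L.length_le (by simpa [h0] using hDb)
      (.seq (.const hw (.seq (.mul (z := 8 * k) (by simp [h3]) (by omega)
        (.seq (.add (z := L.base (v, b) + 8 * k) (by simp) (by omega)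
          (.seq (.field (z := G.key T v) (by decide) L.length_le (by simpa using hDk)
            (.ite ?_ ?_))))))))))
    · intro hki
      simp [h1] at hki
      obtain ⟨hg2, hd, hlev⟩ := hg.root hT hki
      refine .seq (.sub (z := i - G.key T v) (by simp [h1]; omega) (by simpa [h1]) (.seq
        (.field (z := L.slot (G.root T v, b)) (by decide) L.length_le (by simpa using hDr)
          (.mov ⟨by omega, ?_, G.root T v, i - G.key T v, ⟨by simp, by simp, hg2.2.1, hg2.le_len⟩,
            hd, fun _ => .inr ⟨hg2, 0, by omega, ?_, ?_⟩⟩))))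
      · iterate 9 refine Frame.update (by omega) ?_
        exact .rfl
      · have := hg2.2.1
        simpa using hki
      · simpa using hlev
    · intro hki
      simp [h1] at hki
      have hx : G.key T v - i < G.key T v := by omega
      have hκ : ∀ v, G.key T (G.next T v) ≤ G.key T v := fun v => by
        rw [G.key_next (v := v)]; omega
      obtain ⟨n, hn, r, hs⟩ := JumpChain.exists_search (m := 2 ^ k)
        (S := fun u => k ≤ rank (u, b)) hκ hμ hm hx (by have := hQ hki; omega)
      obtain ⟨hxr, -, j₀, hj₀⟩ := hs.spec hx
      refine .seq (.sub (z := G.key T v - i) (by simp [h1]; omega)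
        (by simpa using L.value_lt hDk) (.seq ((L.search (μ := μ) hs ⟨by simp, hk, hthr, hmu⟩
          (by simp) hx).mono ?_)))
      rintro t ρ₁ ⟨ht, ⟨e7, hkr, hthr', hmu'⟩, hf, e0, e1, e8⟩
      have hDn := L.node r b k hkr
      have hDk' := L.key r b k hkr
      rw [hthr'] at hDk'
      refine .seq (.field (z := L.slot (r, b)) (by decide) L.length_le (by simpa [e7] using hDn)
        (.seq (.field (z := G.key T r) (by decide) L.length_le (by simpa [e7] using hDk')
          (.sub (z := G.key T r - (G.key T v - i)) (by simp [e8]; omega)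
            (by simpa using L.value_lt hDk') ?_))))
      have hle : G.key T r ≤ G.key T v := by
        rw [hj₀]; exact key_iterate_le (Nat.zero_le _)
      have hit := hg.iterate hT j₀ (by rw [← hj₀]; omega)
      rw [← hj₀, show i - (G.key T v - G.key T r) = G.key T r - (G.key T v - i) by omega] at hit
      obtain ⟨hg2, hd⟩ := hit
      refine ⟨by omega, ?_, r, _, ⟨by simp, by simp, hg2.2.1, hg2.le_len⟩, hd, fun hor => ?_⟩
      · iterate 3 refine Frame.update (by omega) ?_
        refine Frame.trans ?_ hf
        iterate 7 refine Frame.update (by omega) ?_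
        exact .rfl
      · have hlen : μ ≤ G.len (G.drop T (v, i)).1 := by
          rcases hor with h | h | h
          · omega
          · omega
          · exact h
        -- The key drop at the exit node is the length of the child that the descent enters, hence
        -- at least `μ`, as `Search.near` requires.
        obtain ⟨J, hJ1, hJ2, hJ3, hJ4, hJ5⟩ := hg.exists_exit hT hki
        rw [hJ4, ← hJ5] at hlen
        have hky := G.key_next (T := T) (v := (G.next T)^[J] v)
        have hJ1' := hJ1
        rw [Function.iterate_succ_apply'] at hJ1'
        have hdep : J + 1 ≤ G.depth T v := by
          have hyi : G.Inner T ((G.next T)^[J] v) := by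
            by_contra hni
            have := wt_of_not_inner hni
            omega
          have := inner_iff_depth_pos.1 hyi
          rw [depth_iterate] at this
          omega
        obtain ⟨j, hj, hjr⟩ := hs.near hκ hx hJ2 hJ1
          (by rw [Function.iterate_succ_apply']; omega) (fun a ha => by
            obtain ⟨j, hj, hjk⟩ := hS ((G.next T)^[a] v) (thr_iterate hthr a)
              (by rw [depth_iterate]; omega)
            exact ⟨j, hj, by rw [Nat.add_comm, Function.iterate_add_apply]; exact hjk⟩)
        refine .inr ⟨hg2, j, hj, ?_, ?_⟩
        · rw [← hjr]; omega
        · rw [← hjr]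
          have : G.key T r - (G.key T v - i) - (G.key T r - G.key T ((G.next T)^[J] v)) =
              i - (G.key T v - G.key T ((G.next T)^[J] v)) := by
            have := key_iterate_le (G := G) (T := T) (Nat.zero_le j) (v := r)
            rw [← hjr] at this
            simp only [Function.iterate_zero, id] at this
            omega
          rw [this]
          exact hJ3

/-- One attempt to descend below the threshold level at the scale in register `3`. -/
def attemptCmd : Cmd :=
  .seq approachCmd <| .seq lookupCmd <| .seq (.op .add 9 4 4) finishCmd

theorem Layout.attempt (L : Layout G rank D w) (hw : 8 < 2 ^ w) {b : Bool} {T μ k : ℕ} (hT : 1 ≤ T)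
    (hμ : 1 ≤ μ) {ρ : Regs} {v : V} {i : ℕ} (h : L.At b ρ v i) (h2 : ρ 2 = T) (h3 : ρ 3 = k)
    (h4 : ρ 4 = 2 ^ k) (hk : 2 * 2 ^ k < 2 ^ w)
    (hv : G.lev v < T ∨ G.Good T v i ∧ G.thr b k v = T ∧ G.mu b k v = μ)
    (hS : ∀ u, G.thr b k u = T → 2 ^ k ≤ G.depth T u + 1 →
      ∃ j < 2 ^ k, k ≤ rank ((G.next T)^[j] u, b))
    (hQ : i ≤ G.key T v → i ≤ μ * 2 ^ 2 ^ k) :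
    Post D w attemptCmd ρ fun t ρ' => t ≤ 250 * 2 ^ k ∧ Frame 7 ρ ρ' ∧ ∃ v' i',
      L.At b ρ' v' i' ∧ G.drop T (v', i') = G.drop T (v, i) ∧
        (G.lev v < T ∨ G.key T v < i ∨ μ ≤ G.len (G.drop T (v, i)).1 → G.lev v' < T) := by
  have hm : 1 ≤ 2 ^ k := Nat.one_le_two_pow
  have hap : Post D w approachCmd ρ fun t ρ' => t ≤ 23 * (2 ^ k + 1) ∧ Frame 10 ρ ρ' ∧ ∃ v' i',
      L.At b ρ' v' i' ∧ G.drop T (v', i') = G.drop T (v, i) ∧ (G.lev v' < T ∨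
        (G.Good T v i ∧ G.Good T v' i' ∧ k ≤ rank (v', b) ∧ G.thr b k v' = T ∧ G.mu b k v' = μ ∧
          i' ≤ i ∧ i' + G.key T v = i + G.key T v')) := by
    rcases hv with hv | ⟨hg, hthr, hmu⟩
    · refine (L.approach_low h h2 h3 hv).mono ?_
      rintro t ρ₁ ⟨ht, hf, ha⟩
      exact ⟨by omega, hf, v, i, ha, rfl, .inl hv⟩
    · refine (L.approach hT (2 ^ k - 1) h h2 h3 hg ?_).mono ?_
      · by_cases hd : 2 ^ k ≤ G.depth T v + 1
        · obtain ⟨j, hj, hjk⟩ := hS v hthr hd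
          exact .inl ⟨j, by omega, hjk⟩
        · right; omega
      · rintro t ρ₁ ⟨ht, hf, v', i', ha, hd, hc⟩
        refine ⟨by omega, hf, v', i', ha, hd, hc.imp id ?_⟩
        rintro ⟨hg', hk', ⟨j, rfl⟩, hkey⟩
        have := key_iterate_le (G := G) (T := T) (Nat.zero_le j) (v := v)
        simp only [Function.iterate_zero, id] at this
        exact ⟨hg, hg', hk', thr_iterate hthr j, (mu_iterate hthr j).trans hmu, by omega, hkey⟩
  refine .seq (hap.mono ?_)
  rintro t ρ₁ ⟨ht, hf, v₁, i₁, ha, hd, hc⟩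
  refine .seq ((L.lookup hw hT hμ ha (h2 ▸ hf 2 le_rfl (by norm_num))
    (h3 ▸ hf 3 (by norm_num) (by norm_num)) (hc.imp id fun h => ⟨h.2.1, h.2.2.1, h.2.2.2.1,
      h.2.2.2.2.1⟩) hS ?_).mono ?_)
  · intro hi
    rcases hc with hc | ⟨-, -, -, -, -, h5, h6⟩
    · have : ¬G.Inner T v₁ := fun hI =>
        absurd ((hI.le_lev_next).trans (lev_mono hI.len_next_lt.le)) (not_le.2 hc)
      rw [key_of_not_inner this] at hi
      omega
    · exact h5.trans (hQ (by omega))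
  rintro t' ρ₂ ⟨ht', hf', v₂, i₂, ha', hd', hex⟩
  replace hf' := (hf.mono (by norm_num)).trans hf'
  have e4 := h4 ▸ hf' 4 (by norm_num) (by norm_num)
  refine .seq (.add (z := 2 * 2 ^ k) (by rw [e4]; omega) hk ?_)
  refine (L.finish (by omega) hT (2 * 2 ^ k) (v := v₂) (i := i₂)
    ⟨by simpa using ha'.1, by simpa using ha'.2.1, ha'.2.2⟩
    (by simpa [h2] using hf' 2 le_rfl (by norm_num)) (by simp) hk).mono ?_
  rintro t'' ρ₃ ⟨ht'', hf'', v₃, i₃, ha'', hd'', hlev⟩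
  refine ⟨by omega, (Frame.update (by omega) hf').trans (hf''.mono (by norm_num)), v₃, i₃, ha'',
    hd''.trans (hd'.trans hd), fun hor => hlev (hex ?_)⟩
  rw [← hd] at hor
  rcases hc with hc | ⟨hg, -, -, -, -, -, h6⟩
  · exact .inl hc
  · rcases hor with h | h | h
    · exact absurd hg.1 (not_le.2 h)
    · exact .inr (.inl (by omega))
    · exact .inr (.inr h)

end AccessGraph

/-! ### Combining the attempts of all scales and levels. -/

namespace AccessGraph

open WordRAM

variable {V : Type} {G : AccessGraph V} {rank : V × Bool → ℕ} {D : List ℕ} {w : ℕ}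

/-- Switch to the mirror image. -/
def flipCmd : Cmd :=
  .seq (.field 10 0 0) <| .seq (.op .sub 10 10 1) <| .seq (.const 11 1) <|
  .seq (.op .add 1 10 11) <| .seq (.field 10 0 6) (.mov 0 10)

theorem Layout.flip (L : Layout G rank D w) (hw : 8 < 2 ^ w) {b : Bool} {ρ : Regs} {v : V} {i : ℕ}
    (h : L.At b ρ v i) :
    Post D w flipCmd ρ fun t ρ' => t ≤ 10 ∧ L.At b ρ' (G.mirror v) (G.len v + 1 - i) ∧
      Frame 10 ρ ρ' := by
  obtain ⟨h0, h1, hi, hi'⟩ := h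
  have hlen := L.value_lt (L.len v b)
  refine .seq (.field (by decide) L.length_le (h0 ▸ L.len v b) (.seq (.sub (z := G.len v - i)
    (by simp [h1]; omega) (by simpa using hlen) (.seq (.const (by omega) (.seq (.add
    (z := G.len v + 1 - i) (by simp; omega) (by omega) (.seq (.field
    (z := L.slot (G.mirror v, b)) (by decide) L.length_le (by simpa [h0] using L.mirror v b)
    (.mov ⟨by norm_num, ⟨by simp, by simp, by omega, by rw [G.len_mirror]; omega⟩, ?_⟩))))))))))
  iterate 6 refine Frame.update (by omega) ?_
  exact .rfl

/-- Attempts at increasing scales. -/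
def retryCmd : Cmd :=
  .loop (.seq (.field 10 0 1) <| .seq (.const 11 1) (.op .add 10 10 11)) 2 10
    (.seq (.mov 0 5) <| .seq (.mov 1 6) <| .seq (.const 11 1) <| .seq (.op .add 3 3 11) <|
      .seq (.op .add 4 4 4) attemptCmd)

/-- Sampled nodes occur within `2 ^ k` steps on each path of scale `k`. -/
def Sampled (G : AccessGraph V) (rank : V × Bool → ℕ) : Prop :=
  ∀ b k T u, G.thr b k u = T → 2 ^ k ≤ G.depth T u + 1 →
    ∃ j < 2 ^ k, k ≤ rank ((G.next T)^[j] u, b)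

/-- With `μ = 2 ^ (lev v - 2 ^ k)`, an exit that loses at most `2 ^ k` levels is heavy enough. So a
failure certifies a larger loss, which pays for it. -/
theorem Layout.attempt_narrow (L : Layout G rank D w) (hw : 8 < 2 ^ w) (hS : Sampled G rank)
    {k : ℕ} {ρ : Regs} {v : V} {i : ℕ} (h : L.At true ρ v i) (h2 : ρ 2 = G.lev v) (h3 : ρ 3 = k)
    (h4 : ρ 4 = 2 ^ k) (hk : 2 * 2 ^ k < 2 ^ w) (hT : 1 ≤ G.lev v) (hg : G.Good (G.lev v) v i) :
    Post D w attemptCmd ρ fun t ρ' => t ≤ 250 * 2 ^ k ∧ Frame 7 ρ ρ' ∧ ∃ v' i',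
      L.At true ρ' v' i' ∧ G.drop (G.lev v) (v', i') = G.drop (G.lev v) (v, i) ∧
        (G.lev v ≤ G.lev v' → 2 ^ k < G.lev v - G.lev (G.drop (G.lev v) (v, i)).1) := by
  refine (L.attempt hw hT (μ := G.mu true k v) ?_ h h2 h3 h4 hk (.inr ⟨hg, rfl, rfl⟩) (hS true k _)
    ?_).mono ?_
  · simp only [mu, if_true]
    exact Nat.one_le_two_pow
  · intro hi
    refine hi.trans (key_lt_of_lev.le.trans ?_)
    simp only [mu, if_true]
    rw [← pow_add]
    exact Nat.pow_le_pow_right (by norm_num) (by omega)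
  · rintro t ρ₁ ⟨ht, hf, v', i', ha, hd, hc⟩
    refine ⟨ht, hf, v', i', ha, hd, fun hle => ?_⟩
    by_contra hlt
    refine absurd (hc (.inr (.inr ?_))) (not_lt.2 hle)
    simp only [mu, if_true]
    have h5 := lev_drop_lt hT (G := G) (v, i)
    exact (Nat.pow_le_pow_right (by norm_num) (by omega)).trans (G.le_lev.1 le_rfl)

/-- Each retry restarts from the saved node and doubles `2 ^ k`. It happens only if `2 ^ k < d`, so
the decrease of `4 * d - 2 * 2 ^ k` by `2 * 2 ^ k` covers its cost. -/
theorem Layout.retry (L : Layout G rank D w) (hw : 8 < 2 ^ w) (hlen : ∀ v, 8 * G.len v ≤ 2 ^ w)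
    (hS : Sampled G rank) {k d : ℕ} {ρ : Regs} {v v' : V} {i i' : ℕ} (h : L.At true ρ v' i')
    (h2 : ρ 2 = G.lev v) (h3 : ρ 3 = k) (h4 : ρ 4 = 2 ^ k) (h5 : ρ 5 = L.slot (v, true))
    (h6 : ρ 6 = i) (hT : 1 ≤ G.lev v) (hg : G.Good (G.lev v) v i)
    (hd : G.drop (G.lev v) (v', i') = G.drop (G.lev v) (v, i))
    (hdd : d = G.lev v - G.lev (G.drop (G.lev v) (v, i)).1)
    (hlt : G.lev v ≤ G.lev v' → 2 ^ k < d) :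
    Post D w retryCmd ρ fun t ρ' => t ≤ 7 + 300 * (4 * d - 2 * 2 ^ k) ∧
      L.At true ρ' (G.drop (G.lev v) (v, i)).1 (G.drop (G.lev v) (v, i)).2 := by
  unfold retryCmd
  induction hn : d - 2 ^ k using Nat.strong_induction_on generalizing k ρ v' i' with
  | _ n ih =>
    have hlev : ∀ u, G.lev u ≤ G.len u := fun u => Nat.log_le_self _ _
    have hl1 := hlen v
    have hl2 := hlev v
    have hl3 := hlev v'
    have hl4 := hlen v'
    obtain ⟨h0, h1, hi, hi'⟩ := h
    refine .loop (.seq (.field (by decide) L.length_le (h0 ▸ L.lev v' true) (.seq (.const (by omega)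
      (.add (z := G.lev v' + 1) (by simp) (by omega) ?_)))))
    refine ⟨fun hx => ?_, fun hx => ?_⟩
    · simp [h2] at hx
      rw [drop_of_lt (by simpa using hx)] at hd
      rw [← hd]
      exact ⟨by omega, by simp [h0], by simp [h1], hi, hi'⟩
    · simp [h2] at hx
      have hkd := hlt (by omega)
      have hkk : k < 2 ^ k := Nat.lt_two_pow_self
      have hp : 2 ^ (k + 1) = 2 * 2 ^ k := pow_succ' 2 k
      refine .seq (.mov (.seq (.mov (.seq (.const (by omega) (.seq (.add (z := k + 1)
        (by simp [h3]) (by omega) (.seq (.add (z := 2 ^ (k + 1)) (by simp [h4]; omega) (by omega)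
        ((L.attempt_narrow hw hS (v := v) (i := i) (k := k + 1) ⟨by simp [h5], by simp [h6],
          hg.2.1, hg.le_len⟩ (by simp [h2]) (by simp) (by simp) (by omega) hT hg).mono ?_))))))))))
      rintro t ρ₁ ⟨ht, hf, v₁, i₁, ha, hd', hlt'⟩
      have e2 := hf 2 (by norm_num) (by norm_num)
      have e3 := hf 3 (by norm_num) (by norm_num)
      have e4 := hf 4 (by norm_num) (by norm_num)
      have e5 := hf 5 (by norm_num) (by norm_num)
      have e6 := hf 6 (by norm_num) (by norm_num)
      simp [h2, h5, h6] at e2 e3 e4 e5 e6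
      refine (ih (d - 2 ^ (k + 1)) (by omega) ha e2 e3 e4 e5 e6 hd' (hdd ▸ hlt') rfl).mono ?_
      rintro t' ρ₂ ⟨ht', ha'⟩
      exact ⟨by omega, ha'⟩

/-- Descend from a node to a node of a smaller level; register `10` holds the level. -/
def narrowCmd : Cmd :=
  .seq (.mov 2 10) <| .seq (.field 7 0 5) <| .seq (.field 8 7 0) <| .seq (.field 10 7 4) <|
  .seq (.field 11 10 0) <| .seq (.op .add 8 8 11) <| .seq (.ite 8 1 flipCmd (.mov 10 10)) <|
  .seq (.mov 5 0) <| .seq (.mov 6 1) <| .seq (.const 3 0) <| .seq (.const 4 1) <|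
  .seq attemptCmd retryCmd

theorem Layout.narrow (L : Layout G rank D w) (hw : 8 < 2 ^ w) (hlen : ∀ v, 8 * G.len v ≤ 2 ^ w)
    (hS : Sampled G rank) {ρ : Regs} {v : V} {i : ℕ} (h : L.At true ρ v i)
    (h10 : ρ 10 = G.lev v) (hT : 1 ≤ G.lev v) :
    Post D w narrowCmd ρ fun t ρ' => ∃ v' i', L.At true ρ' v' i' ∧ G.char v' i' = G.char v i ∧
      G.lev v' < G.lev v ∧ t ≤ 1500 * (G.lev v - G.lev v') := by
  obtain ⟨h0, h1, hi, hi'⟩ := h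
  -- Every node has an entry at scale `0`, and in narrow mode its key and root do not depend on the
  -- scale.
  have hDk := L.key v true 0 (Nat.zero_le _)
  have hDr := L.root v true 0 (Nat.zero_le _)
  have hthr : G.thr true 0 v = G.lev v := rfl
  rw [hthr] at hDk hDr
  have hDb := L.base' v true
  have hl := hlen v
  have hkr := key_add_len_root_le (G := G) (T := G.lev v) v
  refine .seq (.mov (.seq (.field (z := L.base (v, true)) (by decide) L.length_le
    (by simpa [h0] using hDb) (.seq (.field (z := G.key (G.lev v) v) (by decide) L.length_le
    (by simpa using hDk) (.seq (.field (z := L.slot (G.root (G.lev v) v, true)) (by decide)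
    L.length_le (by simpa using hDr) (.seq (.field (z := G.len (G.root (G.lev v) v)) (by decide)
    L.length_le (by simpa using L.len _ true) (.seq (.add
    (z := G.key (G.lev v) v + G.len (G.root (G.lev v) v)) (by simp) (by omega) (.seq ?_))))))))))))
  suffices hflip : Post D w (.ite 8 1 flipCmd (.mov 10 10)) _ fun t ρ₁ => t ≤ 12 ∧ ρ₁ 2 = G.lev v ∧
      ∃ v₁ i₁, L.At true ρ₁ v₁ i₁ ∧ G.lev v₁ = G.lev v ∧ G.Good (G.lev v) v₁ i₁ ∧
        G.char v₁ i₁ = G.char v i by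
    refine hflip.mono ?_
    rintro t ρ₁ ⟨ht, e2, v₁, i₁, ha, hlev, hg, hch⟩
    rw [← hlev] at hT hg e2
    refine .seq (.mov (.seq (.mov (.seq (.const (by omega) (.seq (.const (by omega) (.seq
      ((L.attempt_narrow hw hS (v := v₁) (i := i₁) (k := 0) ⟨by simp [ha.1], by simp [ha.2.1],
        ha.2.2⟩ (by simp [e2]) (by simp) (by simp) (by omega) hT hg).mono ?_)))))))))
    rintro t' ρ₂ ⟨ht', hf, v₂, i₂, ha2, hd, hlt⟩
    have e2 := hf 2 (by norm_num) (by norm_num)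
    have e3 := hf 3 (by norm_num) (by norm_num)
    have e4 := hf 4 (by norm_num) (by norm_num)
    have e5 := hf 5 (by norm_num) (by norm_num)
    have e6 := hf 6 (by norm_num) (by norm_num)
    simp [*, ha.1, ha.2.1] at e2 e3 e4 e5 e6
    refine (L.retry hw hlen hS ha2 (hlev ▸ e2) e3 (by simpa using e4) e5 e6 hT hg hd rfl hlt).mono ?_
    rintro t'' ρ₃ ⟨ht'', ha3⟩
    have h5 := lev_drop_lt hT (G := G) (v₁, i₁)
    rw [hlev] at *
    refine ⟨_, _, ha3, ?_, h5, by omega⟩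
    rw [(drop_spec (v₁, i₁) hg.2.1 hg.le_len).1, hch]
  have ha : ∀ x, L.At true x v i → x 2 = G.lev v → Post D w flipCmd x fun t ρ₁ =>
      t ≤ 10 ∧ ρ₁ 2 = G.lev v ∧ L.At true ρ₁ (G.mirror v) (G.len v + 1 - i) := fun x hx e2 => by
    refine (L.flip hw hx).mono ?_
    rintro t ρ₁ ⟨ht, ha, hf⟩
    exact ⟨ht, e2 ▸ hf 2 le_rfl (by norm_num), ha⟩
  refine .ite (fun hlt => ?_) fun hlt => ?_
  · simp [h1] at hlt
    refine (ha _ ⟨by simp [h0], by simp [h1], hi, hi'⟩ (by simp [h10])).mono ?_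
    rintro t ρ₁ ⟨ht, e2, ha⟩
    have := len_eq_key_add v hT rfl (G := G)
    refine ⟨by omega, e2, _, _, ha, lev_mirror v, ⟨(lev_mirror v).ge, by omega, by omega⟩,
      G.char_mirror v i hi hi'⟩
  · simp [h1] at hlt
    exact .mov ⟨by norm_num, by simp [h10], v, i, ⟨by simp [h0], by simp [h1], hi, hi'⟩, rfl,
      ⟨le_rfl, hi, hlt⟩, rfl⟩

/-- Descend to a terminal. -/
def bottomCmd : Cmd := .loop (.seq (.field 10 0 1) (.const 11 0)) 11 10 narrowCmd

theorem Layout.bottom (L : Layout G rank D w) (hw : 8 < 2 ^ w) (hlen : ∀ v, 8 * G.len v ≤ 2 ^ w)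
    (hS : Sampled G rank) {ρ : Regs} {v : V} {i : ℕ} (h : L.At true ρ v i) :
    Post D w bottomCmd ρ fun t ρ' => t ≤ 1510 * G.lev v + 6 ∧
      ∃ v', L.At true ρ' v' 1 ∧ G.char v' 1 = G.char v i := by
  unfold bottomCmd
  induction hn : G.lev v using Nat.strong_induction_on generalizing ρ v i with
  | _ n ih =>
    obtain ⟨h0, h1, hi, hi'⟩ := h
    refine .loop (.seq (.field (by decide) L.length_le (h0 ▸ L.lev v true) (.const (by positivity)
      ⟨fun hx => ?_, fun hx => ?_⟩)))
    · simp at hx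
      have hlt : G.len v < 2 ^ 1 := G.lev_lt.1 (by omega)
      obtain rfl : i = 1 := by omega
      exact ⟨by omega, v, ⟨by simp [h0], by simp [h1], hi, hi'⟩, rfl⟩
    · simp at hx
      refine (L.narrow hw hlen hS (v := v) (i := i) ⟨by simp [h0], by simp [h1], hi, hi'⟩ (by simp)
        hx).mono ?_
      rintro t ρ₁ ⟨v₁, i₁, ha, hch, hlt, ht⟩
      refine (ih _ (hn ▸ hlt) ha rfl).mono ?_
      rintro t' ρ₂ ⟨ht', v₂, ha', hch'⟩
      exact ⟨by omega, v₂, ha', hch'.trans hch⟩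

/-- The scale of a position. -/
def scaleCmd : Cmd :=
  .loop (.seq (.op .shr 12 1 2) (.const 11 0)) 11 12
    (.seq (.op .add 2 2 2) <| .seq (.const 11 1) (.op .add 3 3 11))

/-- The last scale that was too small satisfies `2 ^ k ≤ log i`, and the exponent only doubles once
more. -/
theorem scale_spec (D : List ℕ) (hw : 8 < 2 ^ w) {ρ : Regs} {i k : ℕ} (h1 : ρ 1 = i)
    (h2 : ρ 2 = 2 ^ k) (h3 : ρ 3 = k) (hiw : 8 * i ≤ 2 ^ w) :
    Post D w scaleCmd ρ fun t ρ' => ∃ k', k ≤ k' ∧ t ≤ 7 * (k' - k) + 4 ∧ ρ' 0 = ρ 0 ∧ ρ' 1 = i ∧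
      ρ' 2 = 2 ^ k' ∧ ρ' 3 = k' ∧ i < 2 ^ 2 ^ k' ∧ (2 ^ k' ≤ 2 ^ k ∨ 2 ^ k' ≤ 2 * Nat.log 2 i) := by
  unfold scaleCmd
  induction hn : Nat.log 2 i + 1 - 2 ^ k using Nat.strong_induction_on generalizing k ρ with
  | _ n ih =>
    refine .loop (.seq (.shr (z := i >>> 2 ^ k) (by rw [h1, h2]) (by omega) (.const (by positivity)
      ⟨fun hx => ?_, fun hx => ?_⟩)))
    · simp [Nat.shiftRight_eq_div_pow] at hx
      exact ⟨k, le_rfl, by omega, by simp, by simp [h1], by simp [h2], by simp [h3], hx, .inl le_rfl⟩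
    · simp [Nat.shiftRight_eq_div_pow] at hx
      have hk : 2 ^ k ≤ Nat.log 2 i := Nat.le_log_of_pow_le (by norm_num) hx
      have hlog := Nat.log_le_self 2 i
      have hkk : k < 2 ^ k := Nat.lt_two_pow_self
      have hp : 2 ^ (k + 1) = 2 * 2 ^ k := pow_succ' 2 k
      refine .seq (.add (z := 2 ^ (k + 1)) (by simp [h2]; omega) (by omega) (.seq (.const (by omega)
        (.add (z := k + 1) (by simp [h3]) (by omega) ?_))))
      refine (ih (Nat.log 2 i + 1 - 2 ^ (k + 1)) (by omega) (by simp [h1]) (by simp) (by simp)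
        rfl).mono ?_
      rintro t ρ₁ ⟨k', hk', ht, e0, e1, e2, e3, hlt, hor⟩
      refine ⟨k', by omega, by omega, by simpa using e0, e1, e2, e3, hlt, .inr ?_⟩
      rcases hor with h | h <;> omega

/-- The query program. -/
def queryCmd : Cmd :=
  .seq (.const 10 8) <| .seq (.op .mul 0 0 10) <| .seq (.field 10 0 0) <|
  .seq (.op .sub 10 10 1) <| .seq (.ite 10 1 flipCmd (.mov 10 10)) <|
  .seq (.const 2 1) <| .seq (.const 3 0) <| .seq scaleCmd <| .seq (.mov 4 2) <|
  .seq attemptCmd <| .seq (.field 10 0 7) <| .seq (.mov 0 10) <| .seq bottomCmd <|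
  .seq (.field 10 0 7) (.mov 0 10)

theorem Layout.access_near (L : Layout G rank D w) (hw : 8 < 2 ^ w)
    (hlen : ∀ v, 8 * G.len v ≤ 2 ^ w) (hS : Sampled G rank) {ρ : Regs} {v : V} {i : ℕ}
    (h : L.At false ρ v i) :
    Post D w (.seq (.const 2 1) <| .seq (.const 3 0) <| .seq scaleCmd <| .seq (.mov 4 2) <|
      .seq attemptCmd <| .seq (.field 10 0 7) <| .seq (.mov 0 10) <| .seq bottomCmd <|
      .seq (.field 10 0 7) (.mov 0 10)) ρ fun t ρ' =>
        t ≤ 2000 * (1 + 2 * Nat.log 2 i) ∧ ρ' 0 = G.char v i := by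
  obtain ⟨h0, h1, hi, hi'⟩ := h
  have hl := hlen v
  refine .seq (.const (by omega) (.seq (.const (by omega) (.seq ((scale_spec D hw (i := i) (k := 0)
    (by simp [h1]) (by simp) (by simp) (by omega)).mono ?_)))))
  rintro t ρ₁ ⟨k, -, ht, e0, e1, e2, e3, hik, hor⟩
  have hkk : k < 2 ^ k := Nat.lt_two_pow_self
  have hlog : Nat.log 2 i < i := Nat.log_lt_self 2 (by omega)
  have hkb : 2 ^ k ≤ 1 + 2 * Nat.log 2 i := by
    rcases hor with h | h
    · rw [pow_zero] at h; omega
    · omega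
  simp at e0
  refine .seq (.mov (.seq ((L.attempt hw (T := 2 ^ k) (μ := 1) (b := false) Nat.one_le_two_pow le_rfl
    (v := v) (i := i) (k := k) ⟨by simp [e0, h0], by simp [e1], hi, hi'⟩ (by simp [e2])
    (by simp [e3]) (by simp [e2]) (by omega) ?_ (hS false k _) (fun _ => by omega)).mono ?_)))
  · by_cases hv : G.lev v < 2 ^ k
    · exact .inl hv
    · refine .inr ⟨⟨not_lt.1 hv, hi, ?_⟩, rfl, rfl⟩
      -- The root has length at least `2 ^ 2 ^ k > i`, so the position cannot be to its right.
      have := G.le_lev.1 (le_lev_root (G := G) (not_lt.1 hv))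
      omega
  rintro t' ρ₂ ⟨ht', -, v₁, i₁, ha, hd, hlt⟩
  -- Every exit has weight at least `1 = μ`, so the wide attempt always succeeds.
  have hlt := hlt (.inr (.inr (G.len_pos _)))
  refine .seq (.field (z := L.slot (v₁, true)) (by decide) L.length_le
    (by rw [ha.1]; exact L.twin v₁) (.seq (.mov (.seq ((L.bottom hw hlen hS (v := v₁) (i := i₁)
    ⟨by simp, by simp [ha.2.1], ha.2.2⟩).mono ?_)))))
  rintro t'' ρ₃ ⟨ht'', v₂, ha', hch⟩
  refine .seq (.field (z := G.char v₂ 1) (by decide) L.length_le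
    (by rw [ha'.1]; exact L.char v₂) (.mov ⟨by omega, ?_⟩))
  rw [drop_of_lt (by exact hlt)] at hd
  have := (drop_spec (G := G) (T := 2 ^ k) (v, i) hi hi').1
  rw [← hd] at this
  simp [hch, this]

theorem Layout.query (L : Layout G rank D w) (hw : 8 < 2 ^ w) (hlen : ∀ v, 8 * G.len v ≤ 2 ^ w)
    (hS : Sampled G rank) {ρ : Regs} {v : V} {i a : ℕ} (ha : L.slot (v, false) = 8 * a)
    (h0 : ρ 0 = a) (h1 : ρ 1 = i) (hi : 1 ≤ i) (hi' : i ≤ G.len v) :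
    Post D w queryCmd ρ fun t ρ' =>
      t ≤ 10000 * (1 + Nat.log 2 (min i (G.len v - i))) ∧ ρ' 0 = G.char v i := by
  have hDl := L.len v false
  have haddr := L.addr_lt hDl
  have hl := hlen v
  refine .seq (.const hw (.seq (.mul (z := L.slot (v, false)) (by simp [h0, ha]; omega) (by omega)
    (.seq (.field (z := G.len v) (by decide) L.length_le (by simpa using hDl)
    (.seq (.sub (z := G.len v - i) (by simp [h1]; omega) (by simp; omega) (.seq (.ite ?_ ?_)))))))))
  · intro hlt
    simp [h1] at hlt
    refine (L.flip hw (b := false) (v := v) (i := i) ⟨by simp, by simp [h1], hi, hi'⟩).mono ?_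
    rintro t ρ₁ ⟨ht, ha, -⟩
    refine (L.access_near hw hlen hS ha).mono ?_
    rintro t' ρ₂ ⟨ht', hch⟩
    refine ⟨?_, hch.trans (G.char_mirror v i hi hi')⟩
    have hmin : min i (G.len v - i) = G.len v - i := by omega
    -- The mirrored position is one more than the distance to the right end; this costs at most one
    -- in the logarithm.
    have hlog : Nat.log 2 (G.len v + 1 - i) ≤ Nat.log 2 (G.len v - i) + 1 := by
      rcases Nat.eq_zero_or_pos (G.len v - i) with h | h
      · rw [show G.len v + 1 - i = 1 by omega]; simp
      · rw [← Nat.log_mul_base (by norm_num) (by omega)]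
        exact Nat.log_mono_right (by omega)
    rw [hmin]
    omega
  · intro hlt
    simp [h1] at hlt
    refine .mov ((L.access_near hw hlen hS (v := v) (i := i)
      ⟨by simp, by simp [h1], hi, hi'⟩).mono ?_)
    rintro t' ρ₂ ⟨ht', hch⟩
    rw [Nat.min_eq_left (by omega)]
    exact ⟨by omega, hch⟩

end AccessGraph

/-! ### Straight-line programs as access graphs -/

namespace SLP

variable {n : ℕ} (G : SLP n)

theorem len_of_term {v : Fin n} {a : ℕ} (h : G.rule v = .term a) : G.len v = 1 := by
  rw [len, G.str_of_term h]; rfl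

theorem len_of_pair {v l r : Fin n} (h : G.rule v = .pair l r) :
    G.len v = G.len l + G.len r := by
  rw [len, G.str_of_pair h, List.length_append]; rfl

theorem len_pos (v : Fin n) : 1 ≤ G.len v := by
  induction v using G.acyclic.induction with
  | _ v ih =>
    cases h : G.rule v with
    | term a => rw [G.len_of_term h]
    | pair l r =>
      have := ih l (by rw [h]; exact .inl rfl)
      rw [G.len_of_pair h]
      omega

theorem exists_pair_of_two_le_len {v : Fin n} (hv : 2 ≤ G.len v) :
    ∃ l r, G.rule v = .pair l r := by
  cases h : G.rule v with
  | term a => rw [G.len_of_term h] at hv; omega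
  | pair l r => exact ⟨l, r, rfl⟩

theorem len_le_totalLen (hG : G.Trim) (v : Fin n) : G.len v ≤ G.totalLen := by
  induction hG v with
  | refl => exact le_rfl
  | @tail u u' _ hu ih =>
    refine le_trans ?_ ih
    cases h : G.rule u with
    | term a => rw [h] at hu; exact hu.elim
    | pair l r =>
      rw [h] at hu
      rw [G.len_of_pair h]
      rcases hu with rfl | rfl <;> omega

theorem lt_of_mem_str {w : ℕ} (hG : G.TerminalsFit w) (v : Fin n) : ∀ a ∈ G.str v, a < 2 ^ w := by
  induction v using G.acyclic.induction with
  | _ v ih =>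
    cases h : G.rule v with
    | term a =>
      rw [G.str_of_term h]
      simpa using hG v a h
    | pair l r =>
      rw [G.str_of_pair h]
      intro a ha
      rcases List.mem_append.1 ha with ha | ha
      · exact ih l (by rw [h]; exact .inl rfl) a ha
      · exact ih r (by rw [h]; exact .inr rfl) a ha

/-- The string of a node, reversed if `b` holds. -/
noncomputable def side (v : Fin n) (b : Bool) : List ℕ :=
  if b then (G.str v).reverse else G.str v

theorem length_side (v : Fin n) (b : Bool) : (G.side v b).length = G.len v := by
  cases b <;> simp [side, len]

/-- The right child if `b` holds, and else the left child; terminals are their own children. -/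
def child (v : Fin n) (b : Bool) : Fin n :=
  match G.rule v with
  | .term _ => v
  | .pair l r => if b then r else l

theorem side_eq {v : Fin n} (b : Bool) (hv : 2 ≤ G.len v) :
    G.side v b = G.side (G.child v b) b ++ G.side (G.child v !b) b := by
  obtain ⟨l, r, h⟩ := G.exists_pair_of_two_le_len hv
  cases b <;> simp [side, child, h, G.str_of_pair h]

/-- The access graph of a straight-line program has a second copy of each node, which derives the
reversed string. -/
noncomputable def accessGraph : AccessGraph (Fin n × Bool) where
  len v := G.len v.1
  left v := (G.child v.1 v.2, v.2)
  right v := (G.child v.1 !v.2, v.2)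
  mirror v := (v.1, !v.2)
  char v i := (G.side v.1 v.2).getD (i - 1) 0
  len_pos v := G.len_pos v.1
  len_eq v hv := by
    rw [← G.length_side _ v.2, G.side_eq v.2 hv, List.length_append, length_side, length_side]
  char_left v i hv h1 h2 := by
    rw [G.side_eq v.2 hv, List.getD_append _ _ _ _ (by rw [length_side]; simp only at h2; omega)]
  char_right v i hv h := by
    rw [G.side_eq v.2 hv, List.getD_append_right _ _ _ _ (by rw [length_side]; simp only at h; omega),
      length_side, Nat.sub_right_comm]
  len_mirror _ := rfl
  left_mirror _ := rfl
  right_mirror v := by simp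
  char_mirror v i h1 h2 := by
    obtain ⟨v, b⟩ := v
    simp only [] at h2 ⊢
    have e : ∀ l : List ℕ, l.length = G.len v →
        l.reverse.getD (G.len v + 1 - i - 1) 0 = l.getD (i - 1) 0 := fun l hl => by
      rw [List.getD_eq_getElem _ _ (by rw [List.length_reverse]; omega),
        List.getD_eq_getElem _ _ (by omega), List.getElem_reverse]
      congr 1
      omega
    cases b
    · exact e _ rfl
    · rw [← e _ (G.length_side v true)]
      simp [side]

end SLP

/-! ### Sampling for both modes, and the main theorem. -/

theorem AccessGraph.exists_sampled {V : Type} [Fintype V] (G : AccessGraph V) :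
    ∃ rank : V × Bool → ℕ, ∑ z, (rank z + 1) ≤ 4 * Fintype.card (V × Bool) ∧
      G.Sampled rank := by
  have hit : ∀ k j (z : V × Bool),
      (fun z : V × Bool => (G.next (G.thr z.2 k z.1) z.1, z.2))^[j] z =
        ((G.next (G.thr z.2 k z.1))^[j] z.1, z.2) := by
    intro k j z
    induction j with
    | zero => rfl
    | succ j ih =>
      rw [Function.iterate_succ_apply', ih, Function.iterate_succ_apply']
      simp only [thr_iterate (G := G) (b := z.2) (k := k) (v := z.1) rfl j]
  obtain ⟨rank, h1, h2⟩ := exists_sampling_rank (fun k z => G.depth (G.thr z.2 k z.1) z.1)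
    (fun k z => (G.next (G.thr z.2 k z.1) z.1, z.2)) (fun k j z => by
      rw [hit]
      simp only [thr_iterate (G := G) (b := z.2) (k := k) (v := z.1) rfl j]
      exact depth_iterate j)
  refine ⟨rank, h1, ?_⟩
  rintro b k T u rfl hd
  obtain ⟨j, hj, hk⟩ := h2 k (u, b) hd
  rw [hit] at hk
  exact ⟨j, hj, hk⟩

/-- Fringe access: one query program `P` and one constant `C` serve all straight-line programs and
all word lengths. Positions are `1`-based, and the bounds `Nat.log 2 0 = Nat.log 2 1 = 0` together
with the summand `1` give the usual meaning of `O(log min(i, N_v - i) + log log N)` when the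
logarithms vanish or are undefined. -/
theorem mainTheorem2 :
    ∃ (P : WordRAM.Program) (C : ℕ),
      ∀ (n : ℕ) (G : SLP n) (w : ℕ),
        G.Trim → C * (n + G.totalLen) ≤ 2 ^ w → G.TerminalsFit w →
        ∃ D : List ℕ, D.length ≤ C * n ∧ (∀ x ∈ D, x < 2 ^ w) ∧
          ∀ (v : Fin n) (i : ℕ) (h₁ : 1 ≤ i) (h₂ : i ≤ (G.str v).length),
            WordRAM.Answers P w D v i
              (C * (1 + Nat.log 2 (min i (G.len v - i)) + Nat.log 2 (Nat.log 2 G.totalLen)))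
              ((G.str v)[i - 1]'(by omega)) := by
  refine ⟨AccessGraph.queryCmd.program, 10000, fun n G w hG hw hterm => ?_⟩
  have hn : 1 ≤ n := by have := G.start.2; omega
  obtain ⟨rank, hrank, hS⟩ := G.accessGraph.exists_sampled
  simp only [Fintype.card_prod, Fintype.card_fin, Fintype.card_bool] at hrank
  have hlen : ∀ v, 8 * G.accessGraph.len v ≤ 2 ^ w := fun v => by
    have : G.accessGraph.len v ≤ G.totalLen := G.len_le_totalLen hG v.1
    omega
  -- The unreversed wide copies come first, so the record of the input node `v` is at the address `8
  -- * v`.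
  let idx : (Fin n × Bool) × Bool → ℕ := fun z => z.1.1 + n * z.1.2.toNat + 2 * n * z.2.toNat
  have hidx : Function.Injective idx := by
    rintro ⟨⟨v, b⟩, c⟩ ⟨⟨v', b'⟩, c'⟩ h
    have h1 := v.2
    have h2 := v'.2
    simp only [idx] at h
    cases b <;> cases b' <;> cases c <;> cases c' <;> simp [Fin.ext_iff] at h ⊢ <;> omega
  have hm : ∀ z, idx z < 4 * n := by
    rintro ⟨⟨v, b⟩, c⟩
    have h1 := v.2
    simp only [idx]
    cases b <;> cases c <;> simp <;> omega
  obtain ⟨D, hD, L, hL⟩ := G.accessGraph.exists_layout rank (w := w) idx hidx hm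
    (fun v => by have := hlen v; have := G.accessGraph.len_pos v; omega)
    (fun v => by
      have h1 : 0 < (G.side v.1 v.2).length := by rw [G.length_side]; exact G.len_pos _
      have h2 : G.accessGraph.char v 1 = (G.side v.1 v.2)[0] := List.getD_eq_getElem _ _ h1
      have h3 : (G.side v.1 v.2)[0] ∈ G.str v.1 := by
        have := List.getElem_mem h1
        unfold SLP.side at this ⊢
        split at this <;> simp_all
      rw [h2]
      exact G.lt_of_mem_str hterm v.1 _ h3) (by omega)
  refine ⟨D, by omega, L.lt_word, fun v i h₁ h₂ => ?_⟩
  obtain ⟨t, ρ, he, ht, hz⟩ := L.query (by omega) hlen hS (v := (v, false)) (i := i) (a := v)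
    (ρ := (WordRAM.init D v i).reg) (by rw [hL]; simp [idx]) rfl rfl h₁ h₂
  refine he.answers (ht.trans ?_) (hz.trans (List.getD_eq_getElem _ _ _))
  -- The program meets the bound without the iterated logarithm, which is simply added.
  exact Nat.mul_le_mul_left _ (Nat.le_add_right _ _)
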